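/- Let $\mathcal H_q$ be a separable right quaternionic Hilbert space, with inner product $\langle\cdot,\cdot\rangle$ satisfying $\langle xp,y\rangle=\langle x,y\rangle p$ and $\langle x,yp\rangle=\overline{p}\,\langle x,y\rangle$, and let $\Omega_q\subseteq\mathbb H\setminus\mathbb R$ be open, connected and axially symmetric (if $x\in\Omega_q$, $\mathrm{Re}\,y=\mathrm{Re}\,x$ and $|y|=|x|$, then $y\in\Omega_q$). Put $\Omega_{red}=\{\mathrm{Re}(\omega)+\boldsymbol i\,|\mathrm{Im}(\omega)| : \omega\in\Omega_q\}\subseteq\mathbb C$. For a bounded right linear operator $T$ on $\mathcal H_q$ and $\omega\in\mathbb H$ write $Q_\omega(T)=T^2-2\mathrm{Re}(\omega)T+|\omega|^2$. The class $B_1^s(\Omega_q)$ consists of those $T$ such that, for every $\omega\in\Omega_q$, $Q_\omega(T)$ is not invertible, is surjective, and $\dim_{\mathbb H}\ker Q_\omega(T)=1$, and such that the right quaternionic linear span of $\bigcup_{\omega\in\Omega_q}\ker Q_\omega(T)$ is dense in $\mathcal H_q$. A function $f:\Delta\to\mathcal H_q$ on an open set $\Delta\subseteq\mathbb C$ is right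 holomorphic if the right derivative $f'(z)=\lim_{h\to0}(f(z+h)-f(z))h^{-1}$ ($h\in\mathbb C\setminus\{0\}$) exists at every $z\in\Delta$; $f^{(i)}$ denotes the iterated right derivative. For $T\in B_1^s(\Omega_q)$, a right holomorphic frame of $T$ over an open set $\Delta\subseteq\Omega_{red}$ is a right holomorphic $\gamma:\Delta\to\mathcal H_q$ with $0\ne\gamma(\omega)\in\ker Q_\omega(T)$ for all $\omega\in\Delta$. For $\omega_0\in\Omega_{red}$ and a frame $\gamma$ over an open neighbourhood $\Delta\subseteq\Omega_{red}$ of $\omega_0$, let $(e_i)_{i\ge0}$ be obtained from $(\gamma^{(i)}(\omega_0))_{i\ge0}$ by Gram–Schmidt: $$e_i=\frac{w_i}{\|w_i\|},\qquad w_i=\gamma^{(i)}(\omega_0)-\sum_{k=0}^{i-1}e_k\,\langle\gamma^{(i)}(\omega_0),e_k\rangle .$$ The infinite matrix $N(\omega_0)=(\langle Te_j,e_i\rangle)_{i,j\ge0}$ is called a canonical matrix representation of $T$ at $\omega_0$. **Theorem.** Let $T_1,T_2\in B_1^s(\Omega_q)$ and $\omega_0\in\Omega_{red}$. Then $T_1$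 and $T_2$ have canonical matrix representations at $\omega_0$. Moreover, for every canonical matrix representation $N_1(\omega_0)$ of $T_1$ at $\omega_0$ and every canonical matrix representation $N_2(\omega_0)$ of $T_2$ at $\omega_0$ (whatever frames are used), the following are equivalent: $T_1$ and $T_2$ are quaternion unitarily equivalent, i.e. $UT_1=T_2U$ for some bounded right linear $U$ with $U^*U=UU^*=I$; and there exists $\theta\in[0,2\pi)$ such that $$N_2(\omega_0)=e^{-\boldsymbol i\theta}\,N_1(\omega_0)\,e^{\boldsymbol i\theta}$$ (entrywise multiplication on the left and on the right). -/

import Mathlib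

open scoped Quaternion
open Filter Topology MulOpposite

noncomputable section

/-- A right quaternionic inner product space: right multiplication `x p` is written `op p • x`,
and `⟨x, y⟩` is right linear in `x`, conjugate symmetric, and induces the norm of `H` (so that
`⟨x, x⟩` is real, nonnegative, and zero only for `x = 0`). A quaternionic Hilbert space is such a
space which is complete. -/
class QuaternionInnerProductSpace (H : Type*) [NormedAddCommGroup H] [Module ℍ[ℝ]ᵐᵒᵖ H] where
  /-- The quaternionic inner product `⟨x, y⟩`. -/
  qinner : H → H → ℍ[ℝ]
  star_qinner : ∀ x y : H, star (qinner y x) = qinner x y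
  qinner_add_left : ∀ x y z : H, qinner (x + y) z = qinner x z + qinner y z
  qinner_smul_left : ∀ (x y : H) (p : ℍ[ℝ]), qinner (op p • x) y = qinner x y * p
  norm_sq_eq_re_qinner : ∀ x : H, ‖x‖ ^ 2 = (qinner x x).re

open QuaternionInnerProductSpace

/-- `p ∼ q`: equal modulus and equal real part. -/
def AxiallySymmetricTo (p q : ℍ[ℝ]) : Prop := ‖p‖ = ‖q‖ ∧ p.re = q.re

/-- A set of quaternions containing, with each point, its whole `∼`-class. -/
def IsAxiallySymmetric (Ωq : Set ℍ[ℝ]) : Prop :=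
  ∀ x ∈ Ωq, ∀ y, AxiallySymmetricTo y x → y ∈ Ωq

/-- The reduced set `{Re ω + i |Im ω| : ω ∈ Ωq}`, as a subset of `ℂ`. -/
def reducedSet (Ωq : Set ℍ[ℝ]) : Set ℂ := {z | ∃ ω ∈ Ωq, z = ⟨ω.re, ‖ω.im‖⟩}

section Operators

variable {H : Type*} [NormedAddCommGroup H] [NormedSpace ℝ H] [Module ℍ[ℝ]ᵐᵒᵖ H]
  [IsScalarTower ℝ ℍ[ℝ]ᵐᵒᵖ H]

/-- The operator `T² - 2 Re(s) T + |s|²`. The type `H →L[ℍ[ℝ]ᵐᵒᵖ] H` is that of bounded right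
linear operators. -/
def sOp (T : H →L[ℍ[ℝ]ᵐᵒᵖ] H) (s : ℍ[ℝ]) : H →L[ℍ[ℝ]ᵐᵒᵖ] H :=
  T * T - (2 * s.re) • T + (‖s‖ ^ 2) • (1 : H →L[ℍ[ℝ]ᵐᵒᵖ] H)

/-- The `S`-spectrum of `T`. -/
def sSpectrum (T : H →L[ℍ[ℝ]ᵐᵒᵖ] H) : Set ℍ[ℝ] := {s | ¬ IsUnit (sOp T s)}

/-- The kernel of `T² - 2 Re(s) T + |s|²`, a right linear subspace. -/
def sKer (T : H →L[ℍ[ℝ]ᵐᵒᵖ] H) (s : ℍ[ℝ]) : Submodule ℍ[ℝ]ᵐᵒᵖ H :=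
  LinearMap.ker (sOp T s : H →ₗ[ℍ[ℝ]ᵐᵒᵖ] H)

/-- The quaternionic Cowen–Douglas class `B_n^s(Ωq)`. -/
structure IsCowenDouglas (n : ℕ) (Ωq : Set ℍ[ℝ]) (T : H →L[ℍ[ℝ]ᵐᵒᵖ] H) : Prop where
  subset_sSpectrum : Ωq ⊆ sSpectrum T
  range_eq : ∀ ω ∈ Ωq, Set.range (sOp T ω) = Set.univ
  closure_span : closure (Submodule.span ℍ[ℝ]ᵐᵒᵖ (⋃ ω ∈ Ωq, (sKer T ω : Set H)) : Set H) = Set.univ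
  rank_ker : ∀ ω ∈ Ωq, Module.rank ℍ[ℝ]ᵐᵒᵖ (sKer T ω) = n

/-- `f` has right derivative `f'` at `z`: `(f(z + h) - f(z)) h⁻¹ → f'` as `h → 0` in `ℂ`. -/
def HasRightDerivAt (f : ℂ → H) (f' : H) (z : ℂ) : Prop :=
  Tendsto (fun h : ℂ => op ((h : ℍ[ℝ])⁻¹) • (f (z + h) - f z)) (𝓝[≠] 0) (𝓝 f')

/-- `f` is right holomorphic on `Δ`. -/
def RightHolomorphicOn (f : ℂ → H) (Δ : Set ℂ) : Prop :=
  ∀ z ∈ Δ, ∃ f', HasRightDerivAt f f' z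

open Classical in
/-- The right derivative of `f` (zero where it does not exist). -/
def rightDeriv (f : ℂ → H) (z : ℂ) : H :=
  if h : ∃ f', HasRightDerivAt f f' z then h.choose else 0

/-- A right holomorphic frame over `Δ` of the line bundle with fibres
`ker (T² - 2 Re(ω) T + |ω|²)`: a nowhere vanishing right holomorphic cross-section. -/
structure IsRightHolomorphicFrame (T : H →L[ℍ[ℝ]ᵐᵒᵖ] H) (Δ : Set ℂ) (γ : ℂ → H) : Prop where
  holomorphic : RightHolomorphicOn γ Δ
  mem_ker : ∀ ω ∈ Δ, γ ω ∈ sKer T (ω : ℍ[ℝ])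
  ne_zero : ∀ ω ∈ Δ, γ ω ≠ 0

variable [QuaternionInnerProductSpace H]

/-- Quaternionic Gram–Schmidt orthonormalization:
`e i` is the normalization of `v i - ∑_{k < i} e k ⟨v i, e k⟩`. -/
def qGramSchmidt (v : ℕ → H) (i : ℕ) : H :=
  let w := v i - ∑ k : Fin i, op (qinner (v i) (qGramSchmidt v k)) • qGramSchmidt v k
  (‖w‖⁻¹ : ℝ) • w
termination_by i
decreasing_by all_goals exact k.2

/-- The orthonormal system obtained from the derivatives `γ^{(i)}(ω₀)`. -/
def canonicalBasis (γ : ℂ → H) (ω₀ : ℂ) : ℕ → H :=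
  qGramSchmidt fun i => (rightDeriv^[i] γ) ω₀

/-- The matrix of `T` with respect to a sequence `e`: the `(i, j)` entry is `⟨T e_j, e_i⟩`. -/
def matrixOf (T : H →L[ℍ[ℝ]ᵐᵒᵖ] H) (e : ℕ → H) : Matrix ℕ ℕ ℍ[ℝ] :=
  Matrix.of fun i j => qinner (T (e j)) (e i)

/-- `N` is a canonical matrix representation of `T` at `ω₀`: the one given by some right
holomorphic frame over some open neighbourhood of `ω₀` in the reduced set. -/
def IsCanonicalMatrix (T : H →L[ℍ[ℝ]ᵐᵒᵖ] H) (Ωq : Set ℍ[ℝ]) (ω₀ : ℂ) (N : Matrix ℕ ℕ ℍ[ℝ]) :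
    Prop :=
  ∃ (Δ : Set ℂ) (γ : ℂ → H), IsOpen Δ ∧ ω₀ ∈ Δ ∧ Δ ⊆ reducedSet Ωq ∧
    IsRightHolomorphicFrame T Δ γ ∧ N = matrixOf T (canonicalBasis γ ω₀)

/-- `B` is the adjoint of `A`. -/
def IsQAdjoint (A B : H →L[ℍ[ℝ]ᵐᵒᵖ] H) : Prop := ∀ x y : H, qinner (A x) y = qinner x (B y)

/-- `U` is unitary: `U* U = U U* = 1`. -/
def IsQUnitary (U : H →L[ℍ[ℝ]ᵐᵒᵖ] H) : Prop := ∃ V, IsQAdjoint U V ∧ V * U = 1 ∧ U * V = 1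

/-- Quaternion unitary equivalence of `T₁` and `T₂`. -/
def QUnitarilyEquivalent (T₁ T₂ : H →L[ℍ[ℝ]ᵐᵒᵖ] H) : Prop :=
  ∃ U, IsQUnitary U ∧ U * T₁ = T₂ * U

end Operators

/-- The entrywise product `e^{-iθ} N e^{iθ}`. -/
def adExp (θ : ℝ) (N : Matrix ℕ ℕ ℍ[ℝ]) : Matrix ℕ ℕ ℍ[ℝ] :=
  Matrix.of fun i j => ((Complex.exp (-(θ * Complex.I)) : ℂ) : ℍ[ℝ]) * N i j *
    ((Complex.exp (θ * Complex.I) : ℂ) : ℍ[ℝ])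

end

/-! Restricting right scalars to `ℂ` makes `H` a complex Hilbert space on which right multiplication
by `j` is antilinear and commutes with `T`. For `Im z > 0` one has `Q_z = (T - z)(T - z̄)`, and `ker
Q_z = E ⊕ E j` with `E = ker (T - z)`, since `j` exchanges the eigenvalues `z` and `z̄`.
Quaternionic dimension one thus means that `E` is a complex line (`exists_eigenvector`,
`eigenvector_unique`).

A holomorphic frame of `ker Q_z` must lie in `ker (T - z)`: a holomorphic section with eigenvalue
`z̄` would make conjugation holomorphic (`map_eq_smul_of_quadratic`). Two frames therefore differ by
a scalar holomorphic `φ`. By Leibniz their derivatives at `ω₀` differ by a triangular change with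
constant diagonal `φ(ω₀)`, so Gram–Schmidt changes every `e_i` by the single phase `φ(ω₀)/|φ(ω₀)|`
(`canonicalBasis_unique`).

The canonical system is an orthonormal basis: the derivatives form a Jordan chain, hence are
independent over `ℍ` (`jordanChain_not_mem_span`), and a vector orthogonal to all of them is
orthogonal to every eigenvector by analytic continuation over the connected reduced set
(`isQTotal_canonicalBasis`). A unitary intertwiner carries frames to frames, so the matrices agree
up to a phase. Conversely, matrices equal up to a phase define a unitary intertwiner from one basis
to the other. -/

open scoped Quaternion
open Filter Topology MulOpposite

noncomputable section

open QuaternionInnerProductSpace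

namespace QuaternionInnerProductSpace

/-! ### The underlying complex Hilbert space and right derivatives. -/

section QuaternionicInner

variable {H : Type*} [NormedAddCommGroup H] [Module ℍ[ℝ]ᵐᵒᵖ H] [QuaternionInnerProductSpace H]

theorem qinner_smul_right (x y : H) (p : ℍ[ℝ]) :
    qinner x (op p • y) = star p * qinner x y := by
  rw [← star_qinner, qinner_smul_left, star_mul, star_qinner]

theorem qinner_add_right (x y z : H) : qinner x (y + z) = qinner x y + qinner x z := by
  rw [← star_qinner, qinner_add_left, star_add, star_qinner, star_qinner]

/-- `⟨·, y⟩` as an additive homomorphism. -/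
def qinnerHom (y : H) : H →+ ℍ[ℝ] := AddMonoidHom.mk' (fun x => qinner x y)
  fun a b => qinner_add_left a b y

theorem qinner_zero_left (y : H) : qinner (0 : H) y = 0 := (qinnerHom y).map_zero

theorem qinner_sub_left (x y z : H) : qinner (x - y) z = qinner x z - qinner y z :=
  (qinnerHom z).map_sub x y

theorem qinner_sum_left {ι : Type*} (s : Finset ι) (f : ι → H) (z : H) :
    qinner (∑ i ∈ s, f i) z = ∑ i ∈ s, qinner (f i) z :=
  map_sum (qinnerHom z) f s

theorem qinner_self (x : H) : qinner x x = ((‖x‖ ^ 2 : ℝ) : ℍ[ℝ]) := by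
  rw [norm_sq_eq_re_qinner, ← Quaternion.star_eq_self, star_qinner]

theorem qinner_self_eq_zero {x : H} : qinner x x = 0 ↔ x = 0 := by
  rw [qinner_self, ← Quaternion.coe_zero, Quaternion.coe_inj]
  simp

theorem norm_op_smul (p : ℍ[ℝ]) (x : H) : ‖op p • x‖ = ‖p‖ * ‖x‖ := by
  have h : qinner (op p • x) (op p • x) = (((‖p‖ * ‖x‖) ^ 2 : ℝ) : ℍ[ℝ]) := by
    rw [qinner_smul_left, qinner_smul_right, qinner_self, mul_assoc,
      Quaternion.coe_commutes, ← mul_assoc, Quaternion.star_mul_self,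
      Quaternion.normSq_eq_norm_mul_self, mul_pow, pow_two ‖p‖]
    norm_cast
  rw [qinner_self, Quaternion.coe_inj] at h
  exact (pow_left_inj₀ (norm_nonneg _) (by positivity) two_ne_zero).1 h

/-- The complex component `a` of `q = a + b j`. -/
def complexPart (q : ℍ[ℝ]) : ℂ := ⟨q.re, q.imI⟩

/-- The quaternion unit `j`. -/
def unitJ : ℍ[ℝ] := ⟨0, 0, 1, 0⟩

@[simp] theorem re_unitJ : unitJ.re = 0 := rfl

@[simp] theorem imI_unitJ : unitJ.imI = 0 := rfl

@[simp] theorem imJ_unitJ : unitJ.imJ = 1 := rfl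

@[simp] theorem imK_unitJ : unitJ.imK = 0 := rfl

theorem norm_coeComplex (z : ℂ) : ‖(z : ℍ[ℝ])‖ = ‖z‖ := by
  rw [← pow_left_inj₀ (norm_nonneg _) (norm_nonneg _) two_ne_zero, pow_two,
    ← Quaternion.normSq_eq_norm_mul_self, Complex.sq_norm, Quaternion.normSq_def',
    Complex.normSq_apply]
  simp [pow_two]

/-- For `q = a + b j`, the second complex part is the conjugate of `b`. -/
theorem eq_zero_of_complexPart {q : ℍ[ℝ]} (h1 : complexPart q = 0)
    (h2 : complexPart (star unitJ * q) = 0) : q = 0 := by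
  have a1 := congrArg Complex.re h1
  have a2 := congrArg Complex.im h1
  have a3 := congrArg Complex.re h2
  have a4 := congrArg Complex.im h2
  simp [complexPart] at a1 a2 a3 a4
  ext <;> simp [a1, a2, a3, a4]

theorem quaternion_eq_complex_add (p : ℍ[ℝ]) :
    p = ((⟨p.re, p.imI⟩ : ℂ) : ℍ[ℝ]) + unitJ * ((⟨p.imJ, -p.imK⟩ : ℂ) : ℍ[ℝ]) := by
  ext <;> simp

theorem complex_mul_unitJ (z : ℂ) :
    (z : ℍ[ℝ]) * unitJ = unitJ * (((starRingEnd ℂ) z : ℂ) : ℍ[ℝ]) := by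
  ext <;> simp

theorem unitJ_mul_unitJ : unitJ * unitJ = -1 := by
  ext <;> simp

theorem op_unitJ_smul_op_unitJ_smul {M : Type*} [AddCommGroup M] [Module ℍ[ℝ]ᵐᵒᵖ M] (x : M) :
    op unitJ • op unitJ • x = -x := by
  rw [smul_smul, ← op_mul, unitJ_mul_unitJ, op_neg, op_one, neg_smul, one_smul]

theorem star_coeComplex (z : ℂ) : star (z : ℍ[ℝ]) = (((starRingEnd ℂ) z : ℂ) : ℍ[ℝ]) := by
  ext <;> simp

variable (H) in
/-- The complex Hilbert space underlying a right quaternionic Hilbert space. -/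
@[reducible]
def complexInnerProductSpace : InnerProductSpace ℂ H where
  smul z x := op (z : ℍ[ℝ]) • x
  one_smul x := by
    change op ((1 : ℂ) : ℍ[ℝ]) • x = x
    simp
  mul_smul z w x := by
    change op ((z * w : ℂ) : ℍ[ℝ]) • x = op (z : ℍ[ℝ]) • op (w : ℍ[ℝ]) • x
    rw [smul_smul, ← op_mul, ← Quaternion.coeComplex_mul, mul_comm]
  smul_zero z := smul_zero (op (z : ℍ[ℝ]))
  smul_add z := smul_add (op (z : ℍ[ℝ]))
  add_smul z w x := by
    change op ((z + w : ℂ) : ℍ[ℝ]) • x = op (z : ℍ[ℝ]) • x + op (w : ℍ[ℝ]) • x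
    rw [Quaternion.coeComplex_add, op_add, add_smul]
  zero_smul x := by
    change op ((0 : ℂ) : ℍ[ℝ]) • x = 0
    simp
  norm_smul_le z x := by
    change ‖op (z : ℍ[ℝ]) • x‖ ≤ _
    rw [norm_op_smul, norm_coeComplex]
  -- The arguments are swapped because `inner` is conjugate linear in its first variable, `qinner`
  -- in its second.
  inner x y := complexPart (qinner y x)
  norm_sq_eq_re_inner x := norm_sq_eq_re_qinner x
  conj_inner_symm x y := by
    rw [← star_qinner y x]
    apply Complex.ext <;> simp [complexPart]
  add_left x y z := by
    rw [qinner_add_right]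
    apply Complex.ext <;> simp [complexPart]
  smul_left x y z := by
    change complexPart (qinner y (op (z : ℍ[ℝ]) • x)) = _
    rw [qinner_smul_right]
    apply Complex.ext <;> simp [complexPart]

attribute [local instance] complexInnerProductSpace

theorem complex_smul_eq (z : ℂ) (x : H) : z • x = op (z : ℍ[ℝ]) • x := rfl

theorem complex_inner_eq (x y : H) : inner ℂ x y = complexPart (qinner y x) := rfl

theorem qinner_eq_zero_iff_inner {x y : H} :
    qinner y x = 0 ↔ inner ℂ x y = 0 ∧ inner ℂ (op unitJ • x) y = 0 := by
  simp only [complex_inner_eq, qinner_smul_right]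
  refine ⟨fun h => ?_, fun h => eq_zero_of_complexPart h.1 h.2⟩
  rw [h]
  constructor <;> apply Complex.ext <;> simp [complexPart]

theorem op_smul_eq_complex (p : ℍ[ℝ]) (x : H) :
    op p • x = (⟨p.re, p.imI⟩ : ℂ) • x + (⟨p.imJ, -p.imK⟩ : ℂ) • op unitJ • x := by
  rw [complex_smul_eq, complex_smul_eq, smul_smul, ← op_mul, ← add_smul, ← op_add,
    ← quaternion_eq_complex_add]

theorem op_unitJ_complex_smul (z : ℂ) (x : H) :
    op unitJ • z • x = (starRingEnd ℂ) z • op unitJ • x := by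
  rw [complex_smul_eq, complex_smul_eq, smul_smul, smul_smul, ← op_mul, ← op_mul,
    complex_mul_unitJ]

/-- A bounded right linear operator as an operator on the underlying complex Hilbert space. -/
def toComplexCLM (T : H →L[ℍ[ℝ]ᵐᵒᵖ] H) : H →L[ℂ] H where
  toFun := T
  map_add' := T.map_add
  map_smul' z x := T.map_smul (op (z : ℍ[ℝ])) x
  cont := T.cont

@[simp]
theorem toComplexCLM_apply (T : H →L[ℍ[ℝ]ᵐᵒᵖ] H) (x : H) : toComplexCLM T x = T x := rfl

theorem map_complex_smul (T : H →L[ℍ[ℝ]ᵐᵒᵖ] H) (z : ℂ) (x : H) : T (z • x) = z • T x :=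
  (toComplexCLM T).map_smul z x

/-- Complex scalars act on the right, so right holomorphy is ordinary complex holomorphy and the
usual complex analysis applies. -/
theorem hasRightDerivAt_iff {f : ℂ → H} {f' : H} {z : ℂ} :
    HasRightDerivAt f f' z ↔ HasDerivAt f f' z := by
  rw [hasDerivAt_iff_tendsto_slope_zero]
  have : ∀ h : ℂ, ((h : ℍ[ℝ]))⁻¹ = ((h⁻¹ : ℂ) : ℍ[ℝ]) := fun h =>
    (map_inv₀ Quaternion.ofComplex h).symm
  simp only [HasRightDerivAt, this, complex_smul_eq]

theorem rightDeriv_eq_deriv (f : ℂ → H) : rightDeriv f = deriv f := by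
  funext z
  unfold rightDeriv
  split_ifs with h
  · exact ((hasRightDerivAt_iff.1 h.choose_spec).deriv).symm
  · refine (deriv_zero_of_not_differentiableAt fun hd => h ?_).symm
    exact ⟨_, hasRightDerivAt_iff.2 hd.hasDerivAt⟩

theorem rightDeriv_iterate_eq (f : ℂ → H) (n : ℕ) : rightDeriv^[n] f = iteratedDeriv n f := by
  rw [iteratedDeriv_eq_iterate]
  congr 1
  funext g
  exact rightDeriv_eq_deriv g

theorem rightHolomorphicOn_iff {f : ℂ → H} {Δ : Set ℂ} (hΔ : IsOpen Δ) :
    RightHolomorphicOn f Δ ↔ DifferentiableOn ℂ f Δ := by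
  constructor
  · intro h z hz
    obtain ⟨f', hf'⟩ := h z hz
    exact (hasRightDerivAt_iff.1 hf').differentiableAt.differentiableWithinAt
  · intro h z hz
    exact ⟨_, hasRightDerivAt_iff.2 (h.differentiableAt (hΔ.mem_nhds hz)).hasDerivAt⟩

end QuaternionicInner

end QuaternionInnerProductSpace

/-! ### Holomorphic families of eigenvectors in a complex Hilbert space. -/

section HolomorphicEigenvectors

theorem not_differentiableAt_conj (z : ℂ) :
    ¬ DifferentiableAt ℂ (fun w : ℂ => (starRingEnd ℂ) w) z := by
  intro h
  have h1 := h.hasDerivAt.complexToReal_fderiv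
  have h2 : HasFDerivAt (fun w : ℂ => (starRingEnd ℂ) w)
      (Complex.conjCLE : ℂ →L[ℝ] ℂ) z := Complex.conjCLE.hasFDerivAt
  have h3 := h1.unique h2
  have e1 := congrArg (fun L : ℂ →L[ℝ] ℂ => L 1) h3
  have e2 := congrArg (fun L : ℂ →L[ℝ] ℂ => L Complex.I) h3
  simp at e1 e2
  rw [e1] at e2
  have := congrArg Complex.im e2
  simp at this
  norm_num at this

variable {E : Type*} [NormedAddCommGroup E] [InnerProductSpace ℂ E]

/-- A holomorphic function whose value at each point `z` is an eigenvector for `conj z` vanishes. -/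
theorem eq_zero_of_map_eq_conj_smul (A : E →L[ℂ] E) {Δ : Set ℂ} (hΔ : IsOpen Δ) {δ : ℂ → E}
    (hδ : DifferentiableOn ℂ δ Δ) (h : ∀ z ∈ Δ, A (δ z) = (starRingEnd ℂ) z • δ z) :
    ∀ z ∈ Δ, δ z = 0 := by
  intro z hz
  by_contra hne
  have hd : DifferentiableAt ℂ δ z := hδ.differentiableAt (hΔ.mem_nhds hz)
  have hf : DifferentiableAt ℂ (fun w => innerSL ℂ (δ z) (δ w)) z :=
    (innerSL ℂ (δ z)).differentiableAt.comp z hd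
  have hg : DifferentiableAt ℂ (fun w => innerSL ℂ (δ z) (A (δ w))) z :=
    ((innerSL ℂ (δ z)).comp A).differentiableAt.comp z hd
  have hfz : innerSL ℂ (δ z) (δ z) ≠ 0 := by simpa using hne
  -- The quotient `⟨δ z, A (δ w)⟩ / ⟨δ z, δ w⟩` is holomorphic near `z` and equals `conj w` there.
  refine not_differentiableAt_conj z ((hg.div hf hfz).congr_of_eventuallyEq ?_)
  filter_upwards [hΔ.mem_nhds hz, hf.continuousAt.eventually_ne hfz] with w hw hw0
  simp only [Pi.div_apply, h w hw, map_smul, smul_eq_mul]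
  field_simp

/-- A holomorphic section of `ker (A - z) (A - conj z)` is a section of `ker (A - z)`. -/
theorem map_eq_smul_of_quadratic (A : E →L[ℂ] E) {Δ : Set ℂ} (hΔ : IsOpen Δ) {γ : ℂ → E}
    (hγ : DifferentiableOn ℂ γ Δ)
    (h : ∀ z ∈ Δ, A (A (γ z)) - (z + (starRingEnd ℂ) z) • A (γ z) +
      (z * (starRingEnd ℂ) z) • γ z = 0) :
    ∀ z ∈ Δ, A (γ z) = z • γ z := by
  have := eq_zero_of_map_eq_conj_smul A hΔ (δ := fun z => A (γ z) - z • γ z)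
    ((A.differentiable.comp_differentiableOn hγ).sub (differentiableOn_id.smul hγ)) ?_
  · exact fun z hz => sub_eq_zero.1 (this z hz)
  · intro z hz
    rw [← sub_eq_zero, ← h z hz]
    simp only [map_sub, map_smul]
    module

/-- The restriction of `B` to the orthogonal complement of its kernel is a continuous bijection,
hence invertible by the open mapping theorem. -/
theorem exists_rightInverse_of_surjective [CompleteSpace E] (B : E →L[ℂ] E)
    (hB : Function.Surjective B) : ∃ S : E →L[ℂ] E, ∀ x, B (S x) = x := by
  let K : Submodule ℂ E := LinearMap.ker (B : E →ₗ[ℂ] E)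
  have hK : IsClosed (K : Set E) := B.isClosed_ker
  have : CompleteSpace K := hK.completeSpace_coe
  let C : Kᗮ →L[ℂ] E := B.comp Kᗮ.subtypeL
  have hinj : LinearMap.ker (C : Kᗮ →ₗ[ℂ] E) = ⊥ := by
    rw [LinearMap.ker_eq_bot']
    intro m hm
    have h1 : (m : E) ∈ K := hm
    have h2 : (m : E) ∈ K ⊓ Kᗮ := ⟨h1, m.2⟩
    rw [K.inf_orthogonal_eq_bot] at h2
    exact Subtype.ext h2
  have hsurj : LinearMap.range (C : Kᗮ →ₗ[ℂ] E) = ⊤ := by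
    rw [LinearMap.range_eq_top]
    intro y
    obtain ⟨x, rfl⟩ := hB y
    obtain ⟨a, ha, b, hb, rfl⟩ := K.exists_add_mem_mem_orthogonal x
    refine ⟨⟨b, hb⟩, ?_⟩
    have : B a = 0 := ha
    simp [C, this]
  let e := ContinuousLinearEquiv.ofBijective C hinj hsurj
  refine ⟨Kᗮ.subtypeL.comp (e.symm : E →L[ℂ] Kᗮ), fun x => ?_⟩
  have : C (e.symm x) = x := ContinuousLinearEquiv.ofBijective_apply_symm_apply C hinj hsurj x
  exact this

/-- If `A - z₀` is surjective, every eigenvector for `z₀` extends to a holomorphic family of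
eigenvectors. -/
theorem exists_holomorphic_eigenvector [CompleteSpace E] (A : E →L[ℂ] E) (z₀ : ℂ) (v : E)
    (hv : A v = z₀ • v) (hv0 : v ≠ 0) (hsurj : ∀ y, ∃ x, A x - z₀ • x = y) :
    ∃ (Δ : Set ℂ) (γ : ℂ → E), IsOpen Δ ∧ z₀ ∈ Δ ∧ DifferentiableOn ℂ γ Δ ∧
      (∀ z ∈ Δ, A (γ z) = z • γ z) ∧ ∀ z ∈ Δ, γ z ≠ 0 := by
  obtain ⟨S, hS⟩ := exists_rightInverse_of_surjective (A - z₀ • (1 : E →L[ℂ] E)) hsurj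
  -- The family is `γ z = (1 - (z - z₀) S)⁻¹ v`. Applying `A - z₀` to `γ z - (z - z₀) S (γ z) = v`
  -- gives `(A - z₀) (γ z) = (z - z₀) γ z`.
  let u : ℂ → (E →L[ℂ] E) := fun z => 1 - (z - z₀) • S
  have hu : Differentiable ℂ u := by fun_prop
  have hopen : IsOpen {z | IsUnit (u z)} := Units.isOpen.preimage hu.continuous
  have key : ∀ z, IsUnit (u z) →
      Ring.inverse (u z) v - (z - z₀) • S (Ring.inverse (u z) v) = v := by
    intro z hz
    have := congrArg (fun L : E →L[ℂ] E => L v) (Ring.mul_inverse_cancel _ hz)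
    simpa [u] using this
  refine ⟨{z | IsUnit (u z)}, fun z => Ring.inverse (u z) v, hopen, by simp [u], ?_, ?_, ?_⟩
  · intro z hz
    have h1 : DifferentiableAt ℂ Ring.inverse (u z) := by
      obtain ⟨w, hw⟩ := hz
      rw [← hw]
      exact differentiableAt_inverse w.isUnit
    have h2 : DifferentiableAt ℂ (fun z => Ring.inverse (u z)) z := h1.comp z hu.differentiableAt
    exact (h2.clm_apply (differentiableAt_const v)).differentiableWithinAt
  · intro z hz
    have h1 := key z hz
    set g := Ring.inverse (u z) v
    have h2 := congrArg (A - z₀ • (1 : E →L[ℂ] E)) h1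
    rw [map_sub, map_smul, hS] at h2
    simp only [sub_apply, smul_apply,
      one_apply_eq_self, hv, sub_self] at h2
    rw [← sub_eq_zero, ← h2]
    module
  · intro z hz h0
    have h1 := key z hz
    simp only [h0, map_zero, smul_zero, sub_zero] at h1
    exact hv0 h1.symm

theorem iteratedDeriv_clm_comp {F : Type*} [NormedAddCommGroup F] [NormedSpace ℂ F]
    [CompleteSpace E] (A : E →L[ℂ] F) {Δ : Set ℂ} (hΔ : IsOpen Δ) {γ : ℂ → E}
    (hγ : DifferentiableOn ℂ γ Δ) (n : ℕ) {z : ℂ} (hz : z ∈ Δ) :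
    iteratedDeriv n (fun w => A (γ w)) z = A (iteratedDeriv n γ z) := by
  have : ContDiffAt ℂ n γ z := (hγ.analyticAt (hΔ.mem_nhds hz)).contDiffAt
  have h := A.iteratedFDeriv_comp_left (i := n) this le_rfl
  simp only [iteratedDeriv_eq_iteratedFDeriv]
  change iteratedFDeriv ℂ n (A ∘ γ) z _ = _
  rw [h]
  rfl

/-- The Leibniz rule for a scalar function times a vector function, up to lower order terms. -/
theorem exists_iteratedDeriv_smul_eq {f : ℂ → ℂ} {g : ℂ → E} {z : ℂ} (n : ℕ)
    (hf : ContDiffAt ℂ n f z) (hg : ContDiffAt ℂ n g z) :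
    ∃ c : ℕ → ℂ, iteratedDeriv n (fun w => f w • g w) z =
      f z • iteratedDeriv n g z + ∑ k ∈ Finset.range n, c k • iteratedDeriv k g z := by
  have h := iteratedDerivWithin_smul (Set.mem_univ z) uniqueDiffOn_univ hf.contDiffWithinAt
    hg.contDiffWithinAt (n := n)
  simp only [iteratedDerivWithin_univ] at h
  refine ⟨fun k => (n.choose (n - k) : ℂ) * iteratedDeriv (n - k) f z, ?_⟩
  change iteratedDeriv n (f • g) z = _
  rw [h, Finset.sum_range_succ', add_comm, ← Finset.sum_range_reflect]
  congr 1
  · simp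
  · refine Finset.sum_congr rfl fun k hk => ?_
    have hk := Finset.mem_range.1 hk
    have e1 : n - 1 - k + 1 = n - k := by omega
    have e2 : n - (n - k) = k := by omega
    rw [e1, e2, mul_smul, Nat.cast_smul_eq_nsmul]

/-- The derivatives of a holomorphic family of eigenvectors form a Jordan chain. -/
theorem map_iteratedDeriv_succ_eigenvector [CompleteSpace E] (A : E →L[ℂ] E) {Δ : Set ℂ}
    (hΔ : IsOpen Δ) {γ : ℂ → E} (hγ : DifferentiableOn ℂ γ Δ) (h : ∀ z ∈ Δ, A (γ z) = z • γ z)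
    (n : ℕ) : ∀ z ∈ Δ, A (iteratedDeriv (n + 1) γ z) =
      z • iteratedDeriv (n + 1) γ z + ((n + 1 : ℕ) : ℂ) • iteratedDeriv n γ z := by
  have hcd : ∀ m, ∀ z ∈ Δ, DifferentiableAt ℂ (iteratedDeriv m γ) z := fun m z hz =>
    iteratedDeriv_eq_iterate (n := m) (f := γ) ▸
      (AnalyticAt.iterated_deriv (hγ.analyticAt (hΔ.mem_nhds hz)) m).differentiableAt
  induction n with
  | zero =>
    intro z hz
    have e : (fun w => A (γ w)) =ᶠ[𝓝 z] fun w => w • γ w := by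
      filter_upwards [hΔ.mem_nhds hz] with w hw using h w hw
    have h1 := (A.hasFDerivAt.comp_hasDerivAt z (hcd 0 z hz).hasDerivAt)
    have h2 := (hasDerivAt_id z).smul (hcd 0 z hz).hasDerivAt
    have h3 := (h1.congr_of_eventuallyEq (f := A ∘ iteratedDeriv 0 γ)
      (EventuallyEq.refl _ _)).unique (h2.congr_of_eventuallyEq (by simpa using! e))
    simpa [iteratedDeriv_succ] using h3
  | succ n ih =>
    intro z hz
    have e : (fun w => A (iteratedDeriv (n + 1) γ w)) =ᶠ[𝓝 z] fun w =>
        w • iteratedDeriv (n + 1) γ w + ((n + 1 : ℕ) : ℂ) • iteratedDeriv n γ w := by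
      filter_upwards [hΔ.mem_nhds hz] with w hw using ih w hw
    have h1 := (A.hasFDerivAt.comp_hasDerivAt z (hcd (n + 1) z hz).hasDerivAt)
    have h2 := ((hasDerivAt_id z).smul (hcd (n + 1) z hz).hasDerivAt).add
      ((hcd n z hz).hasDerivAt.const_smul ((n + 1 : ℕ) : ℂ))
    have h3 := h1.unique (h2.congr_of_eventuallyEq e)
    rw [← iteratedDeriv_succ, ← iteratedDeriv_succ] at h3
    rw [h3]
    push_cast
    simp only [id]
    module

/-- A functional annihilating all derivatives at one point of a holomorphic family of eigenvectors
annihilates all eigenvectors. -/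
theorem eigenvector_annihilated_of_iteratedDeriv [CompleteSpace E] (A : E →L[ℂ] E) {V : Set ℂ}
    (hVo : IsOpen V) (hV : IsPreconnected V)
    (hsurj : ∀ z ∈ V, ∀ y, ∃ x, A x - z • x = y) (hex : ∀ z ∈ V, ∃ v, v ≠ 0 ∧ A v = z • v)
    (hker : ∀ z ∈ V, ∀ v w, v ≠ 0 → A v = z • v → A w = z • w → ∃ c : ℂ, w = c • v)
    (ℓ : E →L[ℂ] ℂ) {z₀ : ℂ} (hz₀ : z₀ ∈ V) {Δ : Set ℂ} (hΔ : IsOpen Δ) (hz₀Δ : z₀ ∈ Δ)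
    {γ : ℂ → E} (hγ : DifferentiableOn ℂ γ Δ) (hAγ : ∀ z ∈ Δ, A (γ z) = z • γ z)
    (hγ0 : ∀ z ∈ Δ, γ z ≠ 0) (hℓ : ∀ n, ℓ (iteratedDeriv n γ z₀) = 0) :
    ∀ z ∈ V, ∀ v, A v = z • v → ℓ v = 0 := by
  -- `U` is open, so by connectedness it is enough that it meets `V` and is closed relative to `V`.
  let U : Set ℂ := interior {z | ∀ v, A v = z • v → ℓ v = 0}
  suffices hsub : V ⊆ U from fun z hz => interior_subset (hsub hz)
  refine hV.subset_of_closure_inter_subset isOpen_interior ⟨z₀, hz₀, ?_⟩ ?_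
  · rw [mem_interior_iff_mem_nhds]
    have han : AnalyticAt ℂ (fun w => ℓ (γ w)) z₀ :=
      (ℓ.differentiable.comp_differentiableOn hγ).analyticAt (hΔ.mem_nhds hz₀Δ)
    have hord : analyticOrderAt (fun w => ℓ (γ w)) z₀ = ⊤ := by
      rw [ENat.eq_top_iff_forall_ge]
      intro m
      rw [natCast_le_analyticOrderAt_iff_iteratedDeriv_eq_zero han]
      intro i _
      rw [iteratedDeriv_clm_comp ℓ hΔ hγ i hz₀Δ, hℓ i]
    filter_upwards [analyticOrderAt_eq_top.1 hord, hΔ.mem_nhds hz₀Δ, hVo.mem_nhds hz₀]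
      with w hw hwΔ hwV v hv
    obtain ⟨c, rfl⟩ := hker w hwV _ v (hγ0 w hwΔ) (hAγ w hwΔ) hv
    simp [hw]
  · rintro z₁ ⟨hz₁, hz₁V⟩
    obtain ⟨v, hv0, hv⟩ := hex z₁ hz₁V
    obtain ⟨D, g, hD, hzD, hg, hAg, hg0⟩ :=
      exists_holomorphic_eigenvector A z₁ v hv hv0 (hsurj z₁ hz₁V)
    -- The limit point `z₁` has a ball meeting `U`, so `ℓ ∘ g` vanishes on an open part of the ball
    -- and, by the identity theorem, on all of it.
    obtain ⟨ε, hε, hball⟩ := Metric.isOpen_iff.1 (hD.inter hVo) z₁ ⟨hzD, hz₁V⟩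
    obtain ⟨z₂, hz₂b, hz₂U⟩ := mem_closure_iff.1 hz₁ (Metric.ball z₁ ε) Metric.isOpen_ball
      (Metric.mem_ball_self hε) |>.imp fun _ h => h
    have han : AnalyticOnNhd ℂ (fun w => ℓ (g w)) (Metric.ball z₁ ε) :=
      ((ℓ.differentiable.comp_differentiableOn hg).mono
        (fun w hw => (hball hw).1)).analyticOnNhd Metric.isOpen_ball
    have hz := han.eqOn_zero_of_preconnected_of_eventuallyEq_zero
      (convex_ball z₁ ε).isPreconnected hz₂b (by
        filter_upwards [isOpen_interior.mem_nhds hz₂U, Metric.isOpen_ball.mem_nhds hz₂b]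
          with w hw hwb
        exact interior_subset hw _ (hAg w (hball hwb).1))
    rw [mem_interior_iff_mem_nhds]
    filter_upwards [Metric.ball_mem_nhds z₁ hε] with w hw y hy
    obtain ⟨c, rfl⟩ := hker w (hball hw).2 _ y (hg0 w (hball hw).1) (hAg w (hball hw).1) hy
    rw [map_smul]
    have : ℓ (g w) = 0 := hz hw
    simp [this]

end HolomorphicEigenvectors

namespace QuaternionInnerProductSpace

/-! ### Quaternionic projections and Gram–Schmidt. -/

section Orthonormal

variable {H : Type*} [NormedAddCommGroup H] [Module ℍ[ℝ]ᵐᵒᵖ H] [QuaternionInnerProductSpace H]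

/-- A sequence which is orthonormal for the quaternionic inner product. -/
def IsQOrthonormal (e : ℕ → H) : Prop := ∀ i k, qinner (e i) (e k) = if i = k then 1 else 0

/-- The sum `∑_{k < n} e k ⟨x, e k⟩`. -/
def qProj (e : ℕ → H) (n : ℕ) (x : H) : H := ∑ k ∈ Finset.range n, op (qinner x (e k)) • e k

theorem qProj_add (e : ℕ → H) (n : ℕ) (x y : H) :
    qProj e n (x + y) = qProj e n x + qProj e n y := by
  simp only [qProj, qinner_add_left, op_add, add_smul, Finset.sum_add_distrib]

theorem qProj_op_smul (e : ℕ → H) (n : ℕ) (p : ℍ[ℝ]) (x : H) :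
    qProj e n (op p • x) = op p • qProj e n x := by
  simp only [qProj, qinner_smul_left, op_mul, mul_smul, Finset.smul_sum]

theorem qinner_qProj (e : ℕ → H) {n : ℕ}
    (he : ∀ i < n, ∀ k < n, qinner (e i) (e k) = if i = k then 1 else 0) (x : H) {k : ℕ}
    (hk : k < n) : qinner (qProj e n x) (e k) = qinner x (e k) := by
  rw [qProj, qinner_sum_left, Finset.sum_eq_single k]
  · rw [qinner_smul_left, he k hk k hk, if_pos rfl, one_mul]
  · intro l hl hlk
    rw [qinner_smul_left, he l (Finset.mem_range.1 hl) k hk, if_neg hlk, zero_mul]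
  · intro h
    exact absurd (Finset.mem_range.2 hk) h

theorem qProj_mem_span (e : ℕ → H) (n : ℕ) (x : H) :
    qProj e n x ∈ Submodule.span ℍ[ℝ]ᵐᵒᵖ (e '' Set.Iio n) :=
  Submodule.sum_mem _ fun k hk => Submodule.smul_mem _ _
    (Submodule.subset_span ⟨k, Finset.mem_range.1 hk, rfl⟩)

theorem qProj_eq_self {e : ℕ → H} (he : IsQOrthonormal e) {n : ℕ} {x : H}
    (hx : x ∈ Submodule.span ℍ[ℝ]ᵐᵒᵖ (e '' Set.Iio n)) : qProj e n x = x := by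
  induction hx using Submodule.span_induction with
  | mem x hx =>
    obtain ⟨k, hk, rfl⟩ := hx
    rw [qProj, Finset.sum_eq_single k]
    · rw [he, if_pos rfl, op_one, one_smul]
    · intro l _ hlk
      rw [he, if_neg (Ne.symm hlk), op_zero, zero_smul]
    · intro h
      exact absurd (Finset.mem_range.2 hk) h
  | zero => simp [qProj, qinner_zero_left]
  | add x y _ _ hx hy => rw [qProj_add, hx, hy]
  | smul p x _ hx => rw [← op_unop p, qProj_op_smul, hx]

theorem norm_map_of_qinner_map {U : H →L[ℍ[ℝ]ᵐᵒᵖ] H}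
    (hU : ∀ x y, qinner (U x) (U y) = qinner x y) (x : H) : ‖U x‖ = ‖x‖ := by
  have h := hU x x
  rw [qinner_self, qinner_self, Quaternion.coe_inj] at h
  exact (pow_left_inj₀ (norm_nonneg _) (norm_nonneg _) two_ne_zero).1 h

theorem IsQUnitary.qinner_map_map {U : H →L[ℍ[ℝ]ᵐᵒᵖ] H} (hU : IsQUnitary U) (x y : H) :
    qinner (U x) (U y) = qinner x y := by
  obtain ⟨V, hV, hVU, -⟩ := hU
  rw [hV]
  congr 1
  exact congrArg (fun L : H →L[ℍ[ℝ]ᵐᵒᵖ] H => L y) hVU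

end Orthonormal

theorem real_smul_eq_op_smul {H : Type*} [NormedAddCommGroup H] [NormedSpace ℝ H]
    [Module ℍ[ℝ]ᵐᵒᵖ H] [IsScalarTower ℝ ℍ[ℝ]ᵐᵒᵖ H] (r : ℝ) (x : H) : r • x = op (r : ℍ[ℝ]) • x := by
  have : op (r : ℍ[ℝ]) = r • (1 : ℍ[ℝ]ᵐᵒᵖ) := by
    rw [← op_one, ← op_smul, Algebra.smul_def, mul_one]
    rfl
  rw [this, smul_assoc, one_smul]

section GramSchmidt

variable {H : Type*} [NormedAddCommGroup H] [NormedSpace ℝ H] [Module ℍ[ℝ]ᵐᵒᵖ H]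
  [QuaternionInnerProductSpace H]

theorem qGramSchmidt_eq (v : ℕ → H) (n : ℕ) :
    qGramSchmidt v n = (‖v n - qProj (qGramSchmidt v) n (v n)‖⁻¹ : ℝ) •
      (v n - qProj (qGramSchmidt v) n (v n)) := by
  rw [qGramSchmidt, qProj, Finset.sum_range]

variable [IsScalarTower ℝ ℍ[ℝ]ᵐᵒᵖ H]

theorem qGramSchmidt_eq_op_smul (v : ℕ → H) (n : ℕ) :
    qGramSchmidt v n =
      op ((‖v n - qProj (qGramSchmidt v) n (v n)‖⁻¹ : ℝ) : ℍ[ℝ]) •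
        (v n - qProj (qGramSchmidt v) n (v n)) := by
  rw [← real_smul_eq_op_smul, ← qGramSchmidt_eq]

theorem sub_qProj_eq_op_smul (v : ℕ → H) (n : ℕ) :
    v n - qProj (qGramSchmidt v) n (v n) =
      op ((‖v n - qProj (qGramSchmidt v) n (v n)‖ : ℝ) : ℍ[ℝ]) • qGramSchmidt v n := by
  rw [qGramSchmidt_eq_op_smul v n, smul_smul, ← op_mul, ← Quaternion.coe_mul]
  -- No independence is assumed: a zero remainder makes both sides zero.
  rcases eq_or_ne (v n - qProj (qGramSchmidt v) n (v n)) 0 with h | h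
  · rw [h, smul_zero]
  · rw [inv_mul_cancel₀ (norm_ne_zero_iff.2 h), Quaternion.coe_one, op_one, one_smul]

theorem span_qGramSchmidt (v : ℕ → H) (n : ℕ) :
    Submodule.span ℍ[ℝ]ᵐᵒᵖ (qGramSchmidt v '' Set.Iio n) =
      Submodule.span ℍ[ℝ]ᵐᵒᵖ (v '' Set.Iio n) := by
  induction n with
  | zero => simp
  | succ n ih =>
    have hI : Set.Iio (n + 1) = insert n (Set.Iio n) := by
      ext k
      simp [le_iff_eq_or_lt]
    rw [hI, Set.image_insert_eq, Set.image_insert_eq]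
    have hp := qProj_mem_span (qGramSchmidt v) n (v n)
    apply le_antisymm
    · rw [Submodule.span_le, Set.insert_subset_iff]
      have hle := Submodule.span_mono (R := ℍ[ℝ]ᵐᵒᵖ) (Set.subset_insert (v n) (v '' Set.Iio n))
      constructor
      · rw [SetLike.mem_coe, qGramSchmidt_eq_op_smul]
        exact Submodule.smul_mem _ _ (Submodule.sub_mem _
          (Submodule.subset_span (Set.mem_insert _ _)) (hle (ih ▸ hp)))
      · exact Submodule.subset_span.trans (ih.le.trans hle)
    · rw [Submodule.span_le, Set.insert_subset_iff]
      have hle := Submodule.span_mono (R := ℍ[ℝ]ᵐᵒᵖ)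
        (Set.subset_insert (qGramSchmidt v n) (qGramSchmidt v '' Set.Iio n))
      constructor
      · rw [SetLike.mem_coe, ← sub_add_cancel (v n) (qProj (qGramSchmidt v) n (v n)),
          sub_qProj_eq_op_smul]
        exact Submodule.add_mem _ (Submodule.smul_mem _ _
          (Submodule.subset_span (Set.mem_insert _ _))) (hle hp)
      · exact Submodule.subset_span.trans (ih.ge.trans hle)

theorem isQOrthonormal_qGramSchmidt {v : ℕ → H}
    (hv : ∀ n, v n ∉ Submodule.span ℍ[ℝ]ᵐᵒᵖ (v '' Set.Iio n)) :
    IsQOrthonormal (qGramSchmidt v) := by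
  have key : ∀ n, ∀ i < n, ∀ k < n,
      qinner (qGramSchmidt v i) (qGramSchmidt v k) = if i = k then 1 else 0 := by
    intro n
    induction n with
    | zero => intro i hi; omega
    | succ n ih =>
      have hne : v n - qProj (qGramSchmidt v) n (v n) ≠ 0 := by
        intro h
        apply hv n
        rw [sub_eq_zero.1 h, ← span_qGramSchmidt]
        exact qProj_mem_span _ _ _
      have hnn : qinner (qGramSchmidt v n) (qGramSchmidt v n) = 1 := by
        rw [qinner_self, qGramSchmidt_eq_op_smul, norm_op_smul, Quaternion.norm_coe, norm_inv,
          norm_norm, inv_mul_cancel₀ (norm_ne_zero_iff.2 hne)]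
        simp
      have hnk : ∀ k < n, qinner (qGramSchmidt v n) (qGramSchmidt v k) = 0 := by
        intro k hk
        rw [qGramSchmidt_eq_op_smul v n, qinner_smul_left, qinner_sub_left,
          qinner_qProj _ ih _ hk, sub_self, zero_mul]
      intro i hi k hk
      rcases Nat.lt_succ_iff_lt_or_eq.1 hi with hi | rfl <;>
        rcases Nat.lt_succ_iff_lt_or_eq.1 hk with hk | rfl
      · exact ih i hi k hk
      · rw [← star_qinner, hnk i hi, star_zero, if_neg hi.ne]
      · rw [hnk k hk, if_neg hk.ne']
      · rw [hnn, if_pos rfl]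
  intro i k
  exact key (max i k + 1) i (by omega) k (by omega)

/-- Gram–Schmidt applied to a triangular modification of `v` with constant diagonal `c`. -/
theorem qGramSchmidt_triangular {v v' s : ℕ → H} (he : IsQOrthonormal (qGramSchmidt v))
    {c : ℍ[ℝ]} (hc : c ≠ 0) (hs : ∀ n, s n ∈ Submodule.span ℍ[ℝ]ᵐᵒᵖ (v '' Set.Iio n))
    (hv' : ∀ n, v' n = op c • v n + s n) (n : ℕ) :
    qGramSchmidt v' n = op (((‖c‖⁻¹ : ℝ) : ℍ[ℝ]) * c) • qGramSchmidt v n := by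
  induction n using Nat.strong_induction_on with
  | _ n ih =>
    have hu : ((‖c‖⁻¹ : ℝ) : ℍ[ℝ]) * c * star (((‖c‖⁻¹ : ℝ) : ℍ[ℝ]) * c) = 1 := by
      rw [Quaternion.self_mul_star, Quaternion.normSq_eq_norm_mul_self, norm_mul,
        Quaternion.norm_coe, norm_inv, norm_norm, inv_mul_cancel₀ (norm_ne_zero_iff.2 hc)]
      simp
    -- For unimodular `u`, `e u ⟨x, e u⟩ = e u ū ⟨x, e⟩ = e ⟨x, e⟩`, so the phase does not affect
    -- the projection.
    have hproj : qProj (qGramSchmidt v') n (v' n) = qProj (qGramSchmidt v) n (v' n) := by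
      refine Finset.sum_congr rfl fun k hk => ?_
      rw [ih k (Finset.mem_range.1 hk), qinner_smul_right, smul_smul, ← op_mul, ← mul_assoc, hu,
        one_mul]
    have hw : v' n - qProj (qGramSchmidt v') n (v' n) =
        op c • (v n - qProj (qGramSchmidt v) n (v n)) := by
      rw [hproj, hv', qProj_add, qProj_op_smul, qProj_eq_self he (n := n) (x := s n), smul_sub]
      · abel
      · rw [span_qGramSchmidt]
        exact hs n
    rw [qGramSchmidt_eq_op_smul v' n, hw, qGramSchmidt_eq_op_smul v n, smul_smul, smul_smul,
      norm_op_smul, mul_inv, Quaternion.coe_mul, ← op_mul, ← op_mul]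
    congr 2
    rw [← mul_assoc, ← Quaternion.coe_commutes, ← Quaternion.coe_commutes ‖c‖⁻¹ c]

/-- Gram–Schmidt uses only the linear structure and the inner product, both preserved by `U`. -/
theorem qGramSchmidt_map {U : H →L[ℍ[ℝ]ᵐᵒᵖ] H} (hU : ∀ x y, qinner (U x) (U y) = qinner x y)
    (v : ℕ → H) (n : ℕ) : qGramSchmidt (fun k => U (v k)) n = U (qGramSchmidt v n) := by
  induction n using Nat.strong_induction_on with
  | _ n ih =>
    have hproj : qProj (qGramSchmidt fun k => U (v k)) n (U (v n)) =
        U (qProj (qGramSchmidt v) n (v n)) := by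
      rw [qProj, qProj, map_sum]
      refine Finset.sum_congr rfl fun k hk => ?_
      rw [ih k (Finset.mem_range.1 hk), hU, map_smul]
    rw [qGramSchmidt_eq_op_smul (fun k => U (v k)) n, qGramSchmidt_eq_op_smul v n, hproj, map_smul,
      ← map_sub, norm_map_of_qinner_map hU]

end GramSchmidt

attribute [local instance] complexInnerProductSpace

/-! ### Total sequences and unitaries between quaternionic bases. -/

section Total

variable {H : Type*} [NormedAddCommGroup H] [Module ℍ[ℝ]ᵐᵒᵖ H] [QuaternionInnerProductSpace H]

/-- Only the zero vector is orthogonal to all terms of the sequence. -/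
def IsQTotal (e : ℕ → H) : Prop := ∀ x : H, (∀ n, qinner (e n) x = 0) → x = 0

theorem qinner_eq_zero_symm {x y : H} (h : qinner x y = 0) : qinner y x = 0 := by
  rw [← star_qinner, h, star_zero]

/-- The complex orthonormal family `e 0, e 0 j, e 1, e 1 j, …`. -/
def complexFamily (e : ℕ → H) : ℕ ⊕ ℕ → H := Sum.elim e fun n => op unitJ • e n

theorem IsQTotal.eq_zero {e : ℕ → H} (he : IsQTotal e) {x : H}
    (h : ∀ i, inner ℂ (complexFamily e i) x = 0) : x = 0 :=
  he x fun n => qinner_eq_zero_symm (qinner_eq_zero_iff_inner.2 ⟨h (Sum.inl n), h (Sum.inr n)⟩)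

theorem IsQTotal.span_orthogonal_eq_bot {e : ℕ → H} (he : IsQTotal e) :
    (Submodule.span ℂ (Set.range (complexFamily e)))ᗮ = ⊥ := by
  rw [eq_bot_iff]
  intro x hx
  exact he.eq_zero fun i => hx _ (Submodule.subset_span ⟨i, rfl⟩)

/-- The density principle: an identity defining a closed complex subspace need only be checked on `e
n` and `e n j`. -/
theorem IsQTotal.mem_of_isClosed [CompleteSpace H] {e : ℕ → H} (he : IsQTotal e)
    (S : Submodule ℂ H) (hS : IsClosed (S : Set H)) (h1 : ∀ n, e n ∈ S)
    (h2 : ∀ n, op unitJ • e n ∈ S) (x : H) : x ∈ S := by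
  have : CompleteSpace S := hS.completeSpace_coe
  have hbot : Sᗮ = ⊥ := by
    rw [eq_bot_iff]
    intro y hy
    refine he.eq_zero ?_
    rintro (n | n)
    · exact hy _ (h1 n)
    · exact hy _ (h2 n)
  rw [Submodule.orthogonal_eq_bot_iff.1 hbot]
  trivial

theorem IsQTotal.ext [CompleteSpace H] {e : ℕ → H} (he : IsQTotal e) {A B : H →L[ℍ[ℝ]ᵐᵒᵖ] H}
    (h : ∀ n, A (e n) = B (e n)) : A = B := by
  ext x
  have hm := he.mem_of_isClosed
    (LinearMap.eqLocus (toComplexCLM A : H →ₗ[ℂ] H) (toComplexCLM B : H →ₗ[ℂ] H))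
    (isClosed_eq A.continuous B.continuous) (fun n => h n)
    (fun n => by
      change A (op unitJ • e n) = B (op unitJ • e n)
      rw [map_smul, map_smul, h]) x
  exact hm

theorem IsQTotal.op_smul {e : ℕ → H} (he : IsQTotal e) {c : ℍ[ℝ]} (hc : c ≠ 0) :
    IsQTotal fun n => op c • e n := by
  intro x hx
  refine he x fun n => ?_
  have := hx n
  rw [qinner_smul_left] at this
  exact (mul_eq_zero.1 this).resolve_right hc

theorem IsQOrthonormal.op_smul {e : ℕ → H} (he : IsQOrthonormal e) {c : ℍ[ℝ]}
    (hc : star c * c = 1) : IsQOrthonormal fun n => op c • e n := by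
  intro i k
  rw [qinner_smul_left, qinner_smul_right, he]
  split_ifs <;> simp [hc]

theorem IsQOrthonormal.orthonormal_complexFamily {e : ℕ → H} (he : IsQOrthonormal e) :
    Orthonormal ℂ (complexFamily e) := by
  rw [orthonormal_iff_ite]
  rintro (i | i) (k | k) <;>
    simp only [complexFamily, Sum.elim_inl, Sum.elim_inr, complex_inner_eq, qinner_smul_left,
      qinner_smul_right, he k i, Sum.inl.injEq, Sum.inr.injEq, eq_comm (a := k)] <;>
    split_ifs <;> apply Complex.ext <;> simp_all [complexPart]

/-- The complex Hilbert basis underlying a quaternionic one. -/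
def complexHilbertBasis [CompleteSpace H] {e : ℕ → H} (he : IsQOrthonormal e) (ht : IsQTotal e) :
    HilbertBasis (ℕ ⊕ ℕ) ℂ H :=
  HilbertBasis.mkOfOrthogonalEqBot he.orthonormal_complexFamily ht.span_orthogonal_eq_bot

theorem complexHilbertBasis_apply [CompleteSpace H] {e : ℕ → H} (he : IsQOrthonormal e)
    (ht : IsQTotal e) (i : ℕ ⊕ ℕ) : complexHilbertBasis he ht i = complexFamily e i := by
  rw [complexHilbertBasis, HilbertBasis.coe_mkOfOrthogonalEqBot]

/-- A bounded complex linear operator commuting with right multiplication by `j` is right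
quaternionic linear. -/
def ofComplexCLM (A : H →L[ℂ] H) (hA : ∀ x, A (op unitJ • x) = op unitJ • A x) :
    H →L[ℍ[ℝ]ᵐᵒᵖ] H where
  toFun := A
  map_add' := A.map_add
  map_smul' p x := by
    rw [RingHom.id_apply, ← op_unop p, op_smul_eq_complex (unop p) x,
      op_smul_eq_complex (unop p) (A x), map_add, map_smul, map_smul, hA]
  cont := A.cont

/-- Testing with `y j` in place of `y` recovers the other complex component, which lifts a complex
adjoint relation to a quaternionic one. -/
theorem qinner_eq_of_complexPart_eq {x y x' : H} {V : H → H}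
    (hV : ∀ y, V (op unitJ • y) = op unitJ • V y)
    (h : ∀ y, complexPart (qinner x' y) = complexPart (qinner x (V y))) :
    qinner x' y = qinner x (V y) := by
  have hsub : ∀ p q : ℍ[ℝ], complexPart (p - q) = complexPart p - complexPart q := fun p q => by
    apply Complex.ext <;> simp [complexPart]
  rw [← sub_eq_zero]
  apply eq_zero_of_complexPart
  · rw [hsub, h, sub_self]
  · rw [mul_sub, ← qinner_smul_right, ← qinner_smul_right, ← hV, hsub, h, sub_self]

/-- Two quaternionic orthonormal bases are related by a unitary operator. -/
theorem exists_isQUnitary_map [CompleteSpace H] {e f : ℕ → H} (he : IsQOrthonormal e)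
    (het : IsQTotal e) (hf : IsQOrthonormal f) (hft : IsQTotal f) :
    ∃ U : H →L[ℍ[ℝ]ᵐᵒᵖ] H, IsQUnitary U ∧ ∀ n, U (e n) = f n := by
  classical
  let W : H ≃ₗᵢ[ℂ] H :=
    (complexHilbertBasis he het).repr.trans (complexHilbertBasis hf hft).repr.symm
  have hW : ∀ i, W (complexFamily e i) = complexFamily f i := fun i => by
    rw [← complexHilbertBasis_apply he het, ← complexHilbertBasis_apply hf hft]
    change (complexHilbertBasis hf hft).repr.symm ((complexHilbertBasis he het).repr _) = _
    rw [HilbertBasis.repr_self, HilbertBasis.repr_symm_single]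
  have hW1 : ∀ n, W (e n) = f n := fun n => hW (Sum.inl n)
  have hW2 : ∀ n, W (op unitJ • e n) = op unitJ • f n := fun n => hW (Sum.inr n)
  -- Although right multiplication by `j` is antilinear, this set is a complex subspace: a scalar is
  -- conjugated on both sides of the identity.
  let S : Submodule ℂ H :=
    { carrier := {x | W (op unitJ • x) = op unitJ • W x}
      zero_mem' := by simp
      add_mem' := fun {a b} ha hb => by
        simp only [Set.mem_ofPred_eq] at *
        rw [smul_add, map_add, map_add, smul_add, ha, hb]
      smul_mem' := fun c x hx => by
        simp only [Set.mem_ofPred_eq] at *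
        rw [op_unitJ_complex_smul, W.map_smul, W.map_smul, hx, op_unitJ_complex_smul] }
  have hcont : ∀ p : ℍ[ℝ], Continuous fun x : H => op p • x := fun p =>
    AddMonoidHomClass.continuous_of_bound (DistribSMul.toAddMonoidHom H (op p)) ‖p‖
      fun x => (norm_op_smul p x).le
  have hWJ : ∀ x, W (op unitJ • x) = op unitJ • W x := het.mem_of_isClosed S
    (isClosed_eq (W.continuous.comp (hcont _)) ((hcont _).comp W.continuous))
    (fun n => by
      change W (op unitJ • e n) = op unitJ • W (e n)
      rw [hW1, hW2])
    (fun n => by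
      change W (op unitJ • op unitJ • e n) = op unitJ • W (op unitJ • e n)
      rw [op_unitJ_smul_op_unitJ_smul, hW2, op_unitJ_smul_op_unitJ_smul, map_neg, hW1])
  have hWJ' : ∀ x, W.symm (op unitJ • x) = op unitJ • W.symm x := fun x => by
    rw [LinearIsometryEquiv.symm_apply_eq, hWJ, LinearIsometryEquiv.apply_symm_apply]
  refine ⟨ofComplexCLM (W.toContinuousLinearEquiv : H →L[ℂ] H) hWJ,
    ⟨ofComplexCLM (W.symm.toContinuousLinearEquiv : H →L[ℂ] H) hWJ', ?_, ?_, ?_⟩, hW1⟩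
  · intro x y
    refine qinner_eq_of_complexPart_eq (V := fun y => W.symm y) hWJ' fun y => ?_
    change inner ℂ y (W x) = inner ℂ (W.symm y) x
    rw [← W.inner_map_map (W.symm y) x, LinearIsometryEquiv.apply_symm_apply]
  · ext x
    exact W.symm_apply_apply x
  · ext x
    exact W.apply_symm_apply x

end Total

end QuaternionInnerProductSpace

/-! ### Topology of the reduced set. -/

section ReducedSet

/-- The point `Re ω + i |Im ω|` of the upper half plane. -/
def reducedPoint (ω : ℍ[ℝ]) : ℂ := ⟨ω.re, ‖ω.im‖⟩

theorem axiallySymmetricTo_reducedPoint (ω : ℍ[ℝ]) :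
    AxiallySymmetricTo (reducedPoint ω : ℍ[ℝ]) ω := by
  refine ⟨?_, rfl⟩
  rw [norm_coeComplex, ← pow_left_inj₀ (norm_nonneg _) (norm_nonneg _) two_ne_zero, Complex.sq_norm,
    Complex.normSq_apply, pow_two ‖ω‖, ← Quaternion.normSq_eq_norm_mul_self]
  simp only [reducedPoint, ← Quaternion.normSq_eq_norm_mul_self, Quaternion.normSq_def']
  simp
  ring

theorem reducedPoint_coe {z : ℂ} (hz : 0 < z.im) : reducedPoint (z : ℍ[ℝ]) = z := by
  have h : (z : ℍ[ℝ]).im = ((⟨0, z.im⟩ : ℂ) : ℍ[ℝ]) := by ext <;> simp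
  apply Complex.ext
  · rfl
  · rw [reducedPoint, h, norm_coeComplex, ← abs_of_pos hz]
    simp only
    rw [show (⟨0, |z.im|⟩ : ℂ) = ((|z.im| : ℝ) : ℂ) * Complex.I by
      apply Complex.ext <;> simp]
    simp

theorem continuous_reducedPoint : Continuous reducedPoint := by
  have h : reducedPoint = fun ω => ((ω.re : ℝ) : ℂ) + ((‖ω.im‖ : ℝ) : ℂ) * Complex.I := by
    funext ω
    apply Complex.ext <;> simp [reducedPoint]
  rw [h]
  have := Quaternion.continuous_re
  have := Quaternion.continuous_im
  fun_prop

theorem reducedSet_eq_image (Ωq : Set ℍ[ℝ]) : reducedSet Ωq = reducedPoint '' Ωq := by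
  ext z
  simp only [reducedSet, Set.mem_ofPred_eq, Set.mem_image, reducedPoint, eq_comm (a := z)]

variable {Ωq : Set ℍ[ℝ]}

theorem reducedPoint_mem {ω : ℍ[ℝ]} (hω : ω ∈ Ωq) : reducedPoint ω ∈ reducedSet Ωq := ⟨ω, hω, rfl⟩

theorem coe_mem_of_mem_reducedSet (hsymm : IsAxiallySymmetric Ωq) {z : ℂ}
    (hz : z ∈ reducedSet Ωq) : (z : ℍ[ℝ]) ∈ Ωq := by
  obtain ⟨ω, hω, rfl⟩ := hz
  exact hsymm ω hω _ (axiallySymmetricTo_reducedPoint ω)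

theorem im_pos_of_mem_reducedSet (hreal : ∀ r : ℝ, (r : ℍ[ℝ]) ∉ Ωq) {z : ℂ}
    (hz : z ∈ reducedSet Ωq) : 0 < z.im := by
  obtain ⟨ω, hω, rfl⟩ := hz
  refine norm_pos_iff.2 fun h => hreal ω.re ?_
  rwa [← add_zero (ω.re : ℍ[ℝ]), ← h, Quaternion.re_add_im]

/-- This describes the reduced set as a slice of `Ωq` in the upper half plane, from which its
openness follows. -/
theorem reducedSet_eq (hsymm : IsAxiallySymmetric Ωq) (hreal : ∀ r : ℝ, (r : ℍ[ℝ]) ∉ Ωq) :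
    reducedSet Ωq = {z : ℂ | (z : ℍ[ℝ]) ∈ Ωq} ∩ {z : ℂ | 0 < z.im} := by
  ext z
  constructor
  · exact fun hz => ⟨coe_mem_of_mem_reducedSet hsymm hz, im_pos_of_mem_reducedSet hreal hz⟩
  · rintro ⟨h1, h2⟩
    rw [← reducedPoint_coe h2]
    exact reducedPoint_mem h1

theorem isOpen_reducedSet (hopen : IsOpen Ωq) (hsymm : IsAxiallySymmetric Ωq)
    (hreal : ∀ r : ℝ, (r : ℍ[ℝ]) ∉ Ωq) : IsOpen (reducedSet Ωq) := by
  rw [reducedSet_eq hsymm hreal]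
  have hc : Continuous fun z : ℂ => (z : ℍ[ℝ]) :=
    AddMonoidHomClass.continuous_of_bound Quaternion.ofComplex 1
      fun z => by rw [one_mul]; exact (norm_coeComplex z).le
  exact (hopen.preimage hc).inter (isOpen_lt continuous_const Complex.continuous_im)

theorem isPreconnected_reducedSet (hconn : IsConnected Ωq) : IsPreconnected (reducedSet Ωq) := by
  rw [reducedSet_eq_image]
  exact hconn.isPreconnected.image _ continuous_reducedPoint.continuousOn

end ReducedSet

section Applications

attribute [local instance] complexInnerProductSpace

/-! ### Complex eigenvectors inside the quaternionic kernels. -/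

section Eigenvectors

variable {H : Type*} [NormedAddCommGroup H] [NormedSpace ℝ H] [Module ℍ[ℝ]ᵐᵒᵖ H]
  [IsScalarTower ℝ ℍ[ℝ]ᵐᵒᵖ H]

theorem sOp_congr (T : H →L[ℍ[ℝ]ᵐᵒᵖ] H) {p q : ℍ[ℝ]} (h : AxiallySymmetricTo p q) :
    sOp T p = sOp T q := by
  rw [sOp, sOp, h.1, h.2]

variable [QuaternionInnerProductSpace H]

/-- Since `2 Re z = z + z̄` and `|z|² = z z̄`, the operator factors as `(T - z)(T - z̄)` over `ℂ`.
-/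
theorem sOp_coe_apply (T : H →L[ℍ[ℝ]ᵐᵒᵖ] H) (z : ℂ) (x : H) :
    sOp T (z : ℍ[ℝ]) x =
      T (T x) - (z + (starRingEnd ℂ) z) • T x + (z * (starRingEnd ℂ) z) • x := by
  have h : ∀ (r : ℝ) (y : H), r • y = (r : ℂ) • y := fun r y => by
    rw [real_smul_eq_op_smul, complex_smul_eq, Quaternion.coeComplex_coe]
  rw [Complex.add_conj, Complex.mul_conj, ← h, ← h, ← Complex.sq_norm, ← norm_coeComplex]
  rfl

/-- A vector of the kernel is `a + b j` with eigenvectors `a`, `b`. -/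
theorem exists_eigenvector_decomposition (T : H →L[ℍ[ℝ]ᵐᵒᵖ] H) {z : ℂ} (hz : z.im ≠ 0) {v : H}
    (hv : v ∈ sKer T (z : ℍ[ℝ])) :
    ∃ a b, T a = z • a ∧ T b = z • b ∧ v = a + op unitJ • b := by
  have h0 : T (T v) - (z + (starRingEnd ℂ) z) • T v + (z * (starRingEnd ℂ) z) • v = 0 := by
    rw [← sOp_coe_apply]
    exact hv
  have hd : z - (starRingEnd ℂ) z ≠ 0 := by
    rw [Complex.sub_conj]
    simp [hz]
  have h1 : T (T v) = (z + (starRingEnd ℂ) z) • T v - (z * (starRingEnd ℂ) z) • v := by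
    rw [← sub_eq_zero, ← h0]
    abel
  -- Partial fractions: `v = (z - z̄)⁻¹ ((T - z̄) v - (T - z) v)`. The second term has eigenvalue
  -- `z̄`, and multiplication by `j` turns it into an eigenvector for `z`.
  refine ⟨(z - (starRingEnd ℂ) z)⁻¹ • (T v - (starRingEnd ℂ) z • v),
    op unitJ • (z - (starRingEnd ℂ) z)⁻¹ • (T v - z • v), ?_, ?_, ?_⟩
  · simp only [map_complex_smul, map_sub, h1]
    module
  · simp only [map_smul, map_complex_smul, map_sub, h1]
    rw [← Complex.conj_conj z, ← op_unitJ_complex_smul]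
    simp only [Complex.conj_conj]
    congr 1
    module
  · rw [op_unitJ_smul_op_unitJ_smul, ← smul_neg, ← smul_add]
    rw [eq_inv_smul_iff₀ hd]
    module

variable {T : H →L[ℍ[ℝ]ᵐᵒᵖ] H} {Ωq : Set ℍ[ℝ]}

theorem mem_sKer_of_eigenvector {z : ℂ} {v : H} (hv : T v = z • v) : v ∈ sKer T (z : ℍ[ℝ]) := by
  change sOp T (z : ℍ[ℝ]) v = 0
  rw [sOp_coe_apply, hv, map_complex_smul, hv]
  module

namespace IsCowenDouglas

theorem exists_map_sub_smul_eq (hT : IsCowenDouglas 1 Ωq T) {z : ℂ} (hz : (z : ℍ[ℝ]) ∈ Ωq) (y : H) :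
    ∃ x, T x - z • x = y := by
  obtain ⟨x, rfl⟩ : y ∈ Set.range (sOp T (z : ℍ[ℝ])) := hT.range_eq _ hz ▸ Set.mem_univ y
  refine ⟨T x - (starRingEnd ℂ) z • x, ?_⟩
  rw [sOp_coe_apply, map_sub, map_complex_smul]
  module

theorem exists_eigenvector (hT : IsCowenDouglas 1 Ωq T) {z : ℂ} (hz : (z : ℍ[ℝ]) ∈ Ωq)
    (hz0 : z.im ≠ 0) : ∃ v, v ≠ 0 ∧ T v = z • v := by
  obtain ⟨v, hv, hv0, -⟩ := (rank_submodule_eq_one_iff _).1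
    ((hT.rank_ker _ hz).trans Nat.cast_one)
  obtain ⟨a, b, ha, hb, rfl⟩ := exists_eigenvector_decomposition T hz0 hv
  by_cases h : a = 0
  · exact ⟨b, fun h' => hv0 (by rw [h, h', smul_zero, add_zero]), hb⟩
  · exact ⟨a, h, ha⟩

/-- Rank one gives `w = v r` with `r = c + j d` quaternionic. The part `v j d` has eigenvalue `z̄ ≠
z`, so `d = 0`. -/
theorem eigenvector_unique (hT : IsCowenDouglas 1 Ωq T) {z : ℂ} (hz : (z : ℍ[ℝ]) ∈ Ωq)
    (hz0 : z.im ≠ 0) {v w : H} (hv0 : v ≠ 0) (hv : T v = z • v) (hw : T w = z • w) :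
    ∃ c : ℂ, w = c • v := by
  obtain ⟨u, -, hu0, hu⟩ := (rank_submodule_eq_one_iff _).1
    ((hT.rank_ker _ hz).trans Nat.cast_one)
  obtain ⟨p, hp⟩ := Submodule.mem_span_singleton.1 (hu (mem_sKer_of_eigenvector hv))
  obtain ⟨q, hq⟩ := Submodule.mem_span_singleton.1 (hu (mem_sKer_of_eigenvector hw))
  have hp0 : p ≠ 0 := by
    rintro rfl
    exact hv0 (by rw [← hp, zero_smul])
  have hwv : w = op (unop (q * p⁻¹)) • v := by
    rw [op_unop, ← hp, smul_smul, mul_assoc, inv_mul_cancel₀ hp0, mul_one, hq]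
  generalize unop (q * p⁻¹) = r at hwv
  have hdec := op_smul_eq_complex r v
  rw [← hwv] at hdec
  set c : ℂ := ⟨r.re, r.imI⟩
  set d : ℂ := ⟨r.imJ, -r.imK⟩
  have hd : z - (starRingEnd ℂ) z ≠ 0 := by
    rw [Complex.sub_conj]
    simp [hz0]
  have key : ((z - (starRingEnd ℂ) z) * d) • op unitJ • v = 0 := by
    have h1 := hw
    rw [hdec, map_add, map_complex_smul, map_complex_smul, map_smul, hv, op_unitJ_complex_smul,
      ← sub_eq_zero] at h1
    rw [← neg_eq_zero, ← h1]
    generalize op unitJ • v = u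
    module
  have hJ : op unitJ • v ≠ 0 := fun h => hv0 (by
    rw [← neg_eq_zero, ← op_unitJ_smul_op_unitJ_smul, h, smul_zero])
  have hd0 : d = 0 := ((mul_eq_zero.1 ((smul_eq_zero.1 key).resolve_right hJ))).resolve_left hd
  exact ⟨c, by rw [hdec, hd0, zero_smul, add_zero]⟩

end IsCowenDouglas

end Eigenvectors

section Orthogonal

variable {H : Type*} [NormedAddCommGroup H] [Module ℍ[ℝ]ᵐᵒᵖ H] [QuaternionInnerProductSpace H]

/-- The vectors orthogonal to `x`, a right linear subspace. -/
def qOrthogonal (x : H) : Submodule ℍ[ℝ]ᵐᵒᵖ H where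
  carrier := {v | qinner v x = 0}
  zero_mem' := qinner_zero_left x
  add_mem' {a b} ha hb := by
    simp only [Set.mem_ofPred_eq] at *
    rw [qinner_add_left, ha, hb, add_zero]
  smul_mem' p v hv := by
    simp only [Set.mem_ofPred_eq] at *
    rw [← op_unop p, qinner_smul_left, hv, zero_mul]

theorem mem_qOrthogonal_iff_inner {x v : H} :
    v ∈ qOrthogonal x ↔ innerSL ℂ x v = 0 ∧ innerSL ℂ (op unitJ • x) v = 0 :=
  qinner_eq_zero_iff_inner

theorem isClosed_qOrthogonal (x : H) : IsClosed (qOrthogonal x : Set H) := by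
  have : (qOrthogonal x : Set H) =
      {v | innerSL ℂ x v = 0} ∩ {v | innerSL ℂ (op unitJ • x) v = 0} := by
    ext v
    exact mem_qOrthogonal_iff_inner
  rw [this]
  exact (isClosed_eq (innerSL ℂ x).continuous continuous_const).inter
    (isClosed_eq (innerSL ℂ (op unitJ • x)).continuous continuous_const)

end Orthogonal

/-! ### Frames and their canonical bases. -/

section Frames

theorem canonicalBasis_eq {H : Type*} [NormedAddCommGroup H] [NormedSpace ℝ H]
    [Module ℍ[ℝ]ᵐᵒᵖ H] [QuaternionInnerProductSpace H] (γ : ℂ → H) (z : ℂ) :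
    canonicalBasis γ z = qGramSchmidt fun i => iteratedDeriv i γ z := by
  simp only [canonicalBasis, rightDeriv_iterate_eq]

variable {H : Type*} [NormedAddCommGroup H] [NormedSpace ℝ H] [Module ℍ[ℝ]ᵐᵒᵖ H]
  [IsScalarTower ℝ ℍ[ℝ]ᵐᵒᵖ H] [QuaternionInnerProductSpace H]
  {T : H →L[ℍ[ℝ]ᵐᵒᵖ] H} {Ωq : Set ℍ[ℝ]} {Δ : Set ℂ} {γ : ℂ → H}

theorem IsRightHolomorphicFrame.differentiableOn (hγ : IsRightHolomorphicFrame T Δ γ)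
    (hΔ : IsOpen Δ) : DifferentiableOn ℂ γ Δ :=
  (rightHolomorphicOn_iff hΔ).1 hγ.holomorphic

theorem IsRightHolomorphicFrame.map_eq_smul (hγ : IsRightHolomorphicFrame T Δ γ)
    (hΔ : IsOpen Δ) : ∀ z ∈ Δ, T (γ z) = z • γ z :=
  map_eq_smul_of_quadratic (toComplexCLM T) hΔ (hγ.differentiableOn hΔ) fun z hz => by
    simp only [toComplexCLM_apply]
    rw [← sOp_coe_apply]
    exact hγ.mem_ker z hz

theorem isRightHolomorphicFrame_of_eigenvector (hΔ : IsOpen Δ) (h : DifferentiableOn ℂ γ Δ)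
    (hT : ∀ z ∈ Δ, T (γ z) = z • γ z) (h0 : ∀ z ∈ Δ, γ z ≠ 0) : IsRightHolomorphicFrame T Δ γ :=
  ⟨(rightHolomorphicOn_iff hΔ).2 h, fun z hz => mem_sKer_of_eigenvector (hT z hz), h0⟩

/-- The vectors of a Jordan chain for a non-real eigenvalue are right linearly independent. -/
theorem jordanChain_not_mem_span {z : ℂ} (hz : z.im ≠ 0) {v : ℕ → H} (hv0 : v 0 ≠ 0)
    (h0 : T (v 0) = z • v 0)
    (hs : ∀ n, T (v (n + 1)) = z • v (n + 1) + ((n + 1 : ℕ) : ℂ) • v n) (n : ℕ) :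
    v n ∉ Submodule.span ℍ[ℝ]ᵐᵒᵖ (v '' Set.Iio n) := by
  have hd : z - (starRingEnd ℂ) z ≠ 0 := by
    rw [Complex.sub_conj]
    simp [hz]
  -- `T - z` is only complex linear. `Q` is right quaternionic linear, so kernels of its powers
  -- contain right spans.
  set Q := sOp T (z : ℍ[ℝ]) with hQ
  have q0 : Q (v 0) = 0 := mem_sKer_of_eigenvector h0
  have q1 : Q (v 1) = (z - (starRingEnd ℂ) z) • v 0 := by
    rw [hQ, sOp_coe_apply, hs 0, map_add, map_complex_smul, map_complex_smul, hs 0, h0]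
    push_cast
    module
  have q2 : ∀ n, Q (v (n + 2)) = (((n + 2 : ℕ) : ℂ) * (z - (starRingEnd ℂ) z)) • v (n + 1) +
      (((n + 2 : ℕ) : ℂ) * ((n + 1 : ℕ) : ℂ)) • v n := by
    intro n
    rw [hQ, sOp_coe_apply, hs (n + 1), map_add, map_complex_smul, map_complex_smul, hs (n + 1),
      hs n]
    push_cast
    module
  -- `Q` lowers the chain by one step with leading coefficient `n (z - z̄) ≠ 0`, so `Q ^ n` kills
  -- all earlier vectors but not `v n`.
  have key : ∀ n, (Q ^ (n + 1)) (v n) = 0 ∧ ∃ c : ℂ, c ≠ 0 ∧ (Q ^ n) (v n) = c • v 0 := by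
    intro n
    induction n using Nat.twoStepInduction with
    | zero => exact ⟨by simpa using q0, 1, one_ne_zero, by simp⟩
    | one =>
      refine ⟨?_, z - (starRingEnd ℂ) z, hd, by simpa using q1⟩
      rw [pow_succ, mul_apply_eq_comp, q1, map_complex_smul]
      simp [q0]
    | more n ih1 ih2 =>
      have e : (Q ^ (n + 1 + 1)) (v n) = 0 := by
        rw [pow_succ', mul_apply_eq_comp, ih1.1, map_zero]
      obtain ⟨c, hc, hcv⟩ := ih2.2
      constructor
      · rw [pow_succ, mul_apply_eq_comp, q2, map_add, map_complex_smul,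
          map_complex_smul, ih2.1, e, smul_zero, smul_zero, add_zero]
      · refine ⟨((n + 2 : ℕ) : ℂ) * (z - (starRingEnd ℂ) z) * c,
          mul_ne_zero (mul_ne_zero (Nat.cast_ne_zero.2 (by omega)) hd) hc, ?_⟩
        rw [pow_succ, mul_apply_eq_comp, q2, map_add, map_complex_smul,
          map_complex_smul, hcv, ih1.1, smul_zero, add_zero, smul_smul]
  intro hmem
  have hle : Submodule.span ℍ[ℝ]ᵐᵒᵖ (v '' Set.Iio n) ≤
      LinearMap.ker ((Q ^ n : H →L[ℍ[ℝ]ᵐᵒᵖ] H) : H →ₗ[ℍ[ℝ]ᵐᵒᵖ] H) := by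
    rw [Submodule.span_le]
    rintro _ ⟨k, hk, rfl⟩
    have hk : k < n := hk
    change (Q ^ n) (v k) = 0
    rw [show n = (n - (k + 1)) + (k + 1) by omega, pow_add, mul_apply_eq_comp,
      (key k).1, map_zero]
  obtain ⟨c, hc, hcv⟩ := (key n).2
  have : (Q ^ n) (v n) = 0 := hle hmem
  rw [hcv] at this
  exact (smul_ne_zero hc hv0) this

theorem IsRightHolomorphicFrame.map_unitary {T₁ T₂ U : H →L[ℍ[ℝ]ᵐᵒᵖ] H} (hU : IsQUnitary U)
    (hUT : U * T₁ = T₂ * U) (hΔ : IsOpen Δ) (hγ : IsRightHolomorphicFrame T₁ Δ γ) :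
    IsRightHolomorphicFrame T₂ Δ fun z => U (γ z) := by
  refine isRightHolomorphicFrame_of_eigenvector hΔ
    ((toComplexCLM U).differentiable.comp_differentiableOn (hγ.differentiableOn hΔ))
    (fun z hz => ?_) fun z hz h => ?_
  · have h := congrArg (fun L : H →L[ℍ[ℝ]ᵐᵒᵖ] H => L (γ z)) hUT
    simp only [mul_apply_eq_comp] at h
    rw [← h, hγ.map_eq_smul hΔ z hz, map_complex_smul]
  · have hn := norm_map_of_qinner_map (U := U) (IsQUnitary.qinner_map_map hU) (γ z)
    rw [h, norm_zero] at hn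
    exact hγ.ne_zero z hz (norm_eq_zero.1 hn.symm)

variable [CompleteSpace H]

theorem IsRightHolomorphicFrame.isQOrthonormal_canonicalBasis (hΔ : IsOpen Δ)
    (hγ : IsRightHolomorphicFrame T Δ γ) {z : ℂ} (hz : z ∈ Δ) (hz0 : z.im ≠ 0) :
    IsQOrthonormal (canonicalBasis γ z) := by
  rw [canonicalBasis_eq]
  refine isQOrthonormal_qGramSchmidt (jordanChain_not_mem_span (T := T) hz0 ?_ ?_ fun n => ?_)
  · simpa using hγ.ne_zero z hz
  · simpa using hγ.map_eq_smul hΔ z hz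
  · exact map_iteratedDeriv_succ_eigenvector (toComplexCLM T) hΔ (hγ.differentiableOn hΔ)
      (hγ.map_eq_smul hΔ) n z hz

theorem IsCowenDouglas.exists_frame (hT : IsCowenDouglas 1 Ωq T) (hopen : IsOpen Ωq)
    (hsymm : IsAxiallySymmetric Ωq) (hreal : ∀ r : ℝ, (r : ℍ[ℝ]) ∉ Ωq) {z : ℂ}
    (hz : z ∈ reducedSet Ωq) : ∃ (Δ : Set ℂ) (γ : ℂ → H), IsOpen Δ ∧ z ∈ Δ ∧
      Δ ⊆ reducedSet Ωq ∧ IsRightHolomorphicFrame T Δ γ := by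
  have hzq := coe_mem_of_mem_reducedSet hsymm hz
  obtain ⟨v, hv0, hv⟩ :=
    hT.exists_eigenvector hzq (im_pos_of_mem_reducedSet hreal hz).ne'
  obtain ⟨D, γ, hD, hzD, hγ, hTγ, hγ0⟩ := exists_holomorphic_eigenvector (toComplexCLM T) z v hv hv0
    (hT.exists_map_sub_smul_eq hzq)
  have hDo := hD.inter (isOpen_reducedSet hopen hsymm hreal)
  exact ⟨D ∩ reducedSet Ωq, γ, hDo, ⟨hzD, hz⟩, Set.inter_subset_right,
    isRightHolomorphicFrame_of_eigenvector hDo (hγ.mono Set.inter_subset_left)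
      (fun w hw => hTγ w hw.1) fun w hw => hγ0 w hw.1⟩

theorem IsCowenDouglas.isQTotal_canonicalBasis (hT : IsCowenDouglas 1 Ωq T) (hopen : IsOpen Ωq)
    (hconn : IsConnected Ωq) (hsymm : IsAxiallySymmetric Ωq)
    (hreal : ∀ r : ℝ, (r : ℍ[ℝ]) ∉ Ωq) (hΔ : IsOpen Δ) (hγ : IsRightHolomorphicFrame T Δ γ) {z : ℂ}
    (hz : z ∈ Δ) (hzΩ : z ∈ reducedSet Ωq) : IsQTotal (canonicalBasis γ z) := by
  intro x hx
  rw [canonicalBasis_eq] at hx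
  have him : ∀ w ∈ reducedSet Ωq, w.im ≠ 0 := fun w hw => (im_pos_of_mem_reducedSet hreal hw).ne'
  have hq : ∀ w ∈ reducedSet Ωq, (w : ℍ[ℝ]) ∈ Ωq := fun w hw => coe_mem_of_mem_reducedSet hsymm hw
  have hder : ∀ n, iteratedDeriv n γ z ∈ qOrthogonal x := by
    intro n
    have h1 : iteratedDeriv n γ z ∈
        Submodule.span ℍ[ℝ]ᵐᵒᵖ ((fun i => iteratedDeriv i γ z) '' Set.Iio (n + 1)) :=
      Submodule.subset_span ⟨n, Nat.lt_succ_self n, rfl⟩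
    rw [← span_qGramSchmidt] at h1
    refine Submodule.span_le.2 ?_ h1
    rintro _ ⟨k, -, rfl⟩
    exact hx k
  -- Continuation is complex analytic, so it is applied separately to the functionals of `x` and of
  -- `x j`.
  have hann : ∀ y : H, (∀ n, innerSL ℂ y (iteratedDeriv n γ z) = 0) →
      ∀ w ∈ reducedSet Ωq, ∀ v, T v = w • v → innerSL ℂ y v = 0 := fun y hy =>
    eigenvector_annihilated_of_iteratedDeriv (toComplexCLM T)
      (isOpen_reducedSet hopen hsymm hreal) (isPreconnected_reducedSet hconn)
      (fun w hw => hT.exists_map_sub_smul_eq (hq w hw))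
      (fun w hw => hT.exists_eigenvector (hq w hw) (him w hw))
      (fun w hw _ _ => hT.eigenvector_unique (hq w hw) (him w hw))
      (innerSL ℂ y) hzΩ hΔ hz (hγ.differentiableOn hΔ) (hγ.map_eq_smul hΔ) hγ.ne_zero hy
  have heig : ∀ w ∈ reducedSet Ωq, ∀ v, T v = w • v → v ∈ qOrthogonal x := fun w hw v hv =>
    mem_qOrthogonal_iff_inner.2
      ⟨hann x (fun n => (mem_qOrthogonal_iff_inner.1 (hder n)).1) w hw v hv,
        hann _ (fun n => (mem_qOrthogonal_iff_inner.1 (hder n)).2) w hw v hv⟩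
  have hspan : Submodule.span ℍ[ℝ]ᵐᵒᵖ (⋃ ω ∈ Ωq, (sKer T ω : Set H)) ≤ qOrthogonal x := by
    rw [Submodule.span_le]
    refine Set.iUnion₂_subset fun ω hω v hv => ?_
    have hω' := reducedPoint_mem hω
    have hv' : v ∈ sKer T (reducedPoint ω : ℍ[ℝ]) := by
      rw [sKer, sOp_congr T (axiallySymmetricTo_reducedPoint ω)]
      exact hv
    obtain ⟨a, b, ha, hb, rfl⟩ := exists_eigenvector_decomposition T (him _ hω') hv'
    exact add_mem (heig _ hω' a ha) (Submodule.smul_mem _ _ (heig _ hω' b hb))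
  have hmem : x ∈ closure (Submodule.span ℍ[ℝ]ᵐᵒᵖ (⋃ ω ∈ Ωq, (sKer T ω : Set H)) : Set H) := by
    rw [hT.closure_span]
    trivial
  -- By density `x` itself lies in the closed subspace orthogonal to `x`.
  exact qinner_self_eq_zero.1 (closure_minimal hspan (isClosed_qOrthogonal x) hmem)

/-- The canonical bases of two frames of the same operator differ by a unimodular complex
constant. -/
theorem IsCowenDouglas.canonicalBasis_unique (hT : IsCowenDouglas 1 Ωq T)
    (hsymm : IsAxiallySymmetric Ωq) (hreal : ∀ r : ℝ, (r : ℍ[ℝ]) ∉ Ωq) {Δ' : Set ℂ} {γ' : ℂ → H}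
    (hΔ : IsOpen Δ) (hΔ' : IsOpen Δ') (hsub : Δ ⊆ reducedSet Ωq)
    (hγ : IsRightHolomorphicFrame T Δ γ) (hγ' : IsRightHolomorphicFrame T Δ' γ') {z : ℂ}
    (hz : z ∈ Δ) (hz' : z ∈ Δ') :
    ∃ c : ℂ, ‖c‖ = 1 ∧ ∀ n, canonicalBasis γ' z n = op (c : ℍ[ℝ]) • canonicalBasis γ z n := by
  have hd : DifferentiableOn ℂ γ (Δ ∩ Δ') := (hγ.differentiableOn hΔ).mono Set.inter_subset_left
  have hd' : DifferentiableOn ℂ γ' (Δ ∩ Δ') :=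
    (hγ'.differentiableOn hΔ').mono Set.inter_subset_right
  let ℓ := innerSL ℂ (γ z)
  have hℓ : ℓ (γ z) ≠ 0 := by simpa [ℓ] using hγ.ne_zero z hz
  have hne : ∀ᶠ w in 𝓝 z, ℓ (γ w) ≠ 0 :=
    ((ℓ.continuous.continuousAt.comp
      ((hγ.differentiableOn hΔ).differentiableAt (hΔ.mem_nhds hz)).continuousAt)).eventually_ne hℓ
  -- Pairing with the fixed vector `γ z` expresses the transition function as a quotient of
  -- holomorphic functions.
  let φ : ℂ → ℂ := fun w => ℓ (γ' w) / ℓ (γ w)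
  have hφγ : γ' =ᶠ[𝓝 z] fun w => φ w • γ w := by
    filter_upwards [hne, hΔ.mem_nhds hz, hΔ'.mem_nhds hz'] with w hw hwΔ hwΔ'
    obtain ⟨c, hc⟩ := hT.eigenvector_unique (coe_mem_of_mem_reducedSet hsymm (hsub hwΔ))
      (im_pos_of_mem_reducedSet hreal (hsub hwΔ)).ne' (hγ.ne_zero w hwΔ)
      (hγ.map_eq_smul hΔ w hwΔ) (hγ'.map_eq_smul hΔ' w hwΔ')
    have : φ w = c := by
      simp only [φ, hc, map_smul, smul_eq_mul]
      field_simp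
    rw [this, hc]
  have hnhds : Δ ∩ Δ' ∈ 𝓝 z := (hΔ.inter hΔ').mem_nhds ⟨hz, hz'⟩
  have hγan : AnalyticAt ℂ γ z := hd.analyticAt hnhds
  have hφan : AnalyticAt ℂ φ z :=
    ((ℓ.differentiable.comp_differentiableOn hd').analyticAt hnhds).div
      ((ℓ.differentiable.comp_differentiableOn hd).analyticAt hnhds) hℓ
  have hφ0 : φ z ≠ 0 := by
    intro h
    have := hφγ.eq_of_nhds
    rw [h, zero_smul] at this
    exact hγ'.ne_zero z hz' this
  have hφ0' : ((φ z : ℂ) : ℍ[ℝ]) ≠ 0 := by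
    rw [← norm_ne_zero_iff, norm_coeComplex]
    exact norm_ne_zero_iff.2 hφ0
  have hlead : ∀ n, ∃ s ∈ Submodule.span ℍ[ℝ]ᵐᵒᵖ ((fun i => iteratedDeriv i γ z) '' Set.Iio n),
      iteratedDeriv n γ' z = op (φ z : ℍ[ℝ]) • iteratedDeriv n γ z + s := by
    intro n
    obtain ⟨c, hc⟩ := exists_iteratedDeriv_smul_eq n hφan.contDiffAt hγan.contDiffAt
    refine ⟨_, ?_, (hφγ.iteratedDeriv_eq n).trans hc⟩
    exact Submodule.sum_mem _ fun k hk => Submodule.smul_mem _ (op (c k : ℍ[ℝ]))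
      (Submodule.subset_span ⟨k, Finset.mem_range.1 hk, rfl⟩)
  choose s hs hs' using hlead
  have horth := hγ.isQOrthonormal_canonicalBasis hΔ hz (im_pos_of_mem_reducedSet hreal (hsub hz)).ne'
  rw [canonicalBasis_eq] at horth
  refine ⟨((‖φ z‖⁻¹ : ℝ) : ℂ) * φ z, ?_, fun n => ?_⟩
  · rw [norm_mul, Complex.norm_real, norm_inv, norm_norm, inv_mul_cancel₀ (norm_ne_zero_iff.2 hφ0)]
  · rw [canonicalBasis_eq, canonicalBasis_eq, qGramSchmidt_triangular horth hφ0' hs hs' n,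
      norm_coeComplex, Quaternion.coeComplex_mul, Quaternion.coeComplex_coe]

theorem IsRightHolomorphicFrame.canonicalBasis_map_unitary {U : H →L[ℍ[ℝ]ᵐᵒᵖ] H}
    (hU : IsQUnitary U) (hΔ : IsOpen Δ) (hγ : IsRightHolomorphicFrame T Δ γ) {z : ℂ} (hz : z ∈ Δ) (n : ℕ) :
    canonicalBasis (fun w => U (γ w)) z n = U (canonicalBasis γ z n) := by
  rw [canonicalBasis_eq, canonicalBasis_eq,
    ← qGramSchmidt_map (IsQUnitary.qinner_map_map hU)]
  congr 1
  funext i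
  exact iteratedDeriv_clm_comp (toComplexCLM U) hΔ (hγ.differentiableOn hΔ) i hz

end Frames

/-! ### Matrices and unitary equivalence. -/

section Main

variable {H : Type*} [NormedAddCommGroup H] [Module ℍ[ℝ]ᵐᵒᵖ H] [QuaternionInnerProductSpace H]

theorem exists_exp_of_norm_eq_one {c : ℂ} (hc : ‖c‖ = 1) :
    ∃ θ ∈ Set.Ico (0 : ℝ) (2 * Real.pi), Complex.exp (-(θ * Complex.I)) = c := by
  refine ⟨toIcoMod Real.two_pi_pos 0 (-c.arg), by
    simpa using toIcoMod_mem_Ico Real.two_pi_pos 0 (-c.arg), ?_⟩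
  refine Eq.trans ?_ (Complex.norm_mul_exp_arg_mul_I c)
  rw [toIcoMod, hc, Complex.ofReal_one, one_mul]
  rw [Complex.exp_eq_exp_iff_exists_int]
  refine ⟨toIcoDiv Real.two_pi_pos 0 (-c.arg), ?_⟩
  simp only [zsmul_eq_mul]
  push_cast
  ring

theorem coe_exp_mul_coe_exp_neg (θ : ℝ) :
    ((Complex.exp (θ * Complex.I) : ℂ) : ℍ[ℝ]) * ((Complex.exp (-(θ * Complex.I)) : ℂ) : ℍ[ℝ]) =
      1 := by
  rw [← Quaternion.coeComplex_mul, ← Complex.exp_add, add_neg_cancel, Complex.exp_zero,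
    Quaternion.coeComplex_one]

theorem star_coe_exp_neg (θ : ℝ) :
    star ((Complex.exp (-(θ * Complex.I)) : ℂ) : ℍ[ℝ]) =
      ((Complex.exp (θ * Complex.I) : ℂ) : ℍ[ℝ]) := by
  rw [star_coeComplex, ← Complex.exp_conj]
  simp

/-- Operators with conjugate matrices in orthonormal bases are unitarily equivalent. -/
theorem qUnitarilyEquivalent_of_matrixOf [CompleteSpace H] {T₁ T₂ : H →L[ℍ[ℝ]ᵐᵒᵖ] H} {e f : ℕ → H}
    (he : IsQOrthonormal e) (het : IsQTotal e) (hf : IsQOrthonormal f) (hft : IsQTotal f) {θ : ℝ}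
    (h : matrixOf T₂ f = adExp θ (matrixOf T₁ e)) : QUnitarilyEquivalent T₁ T₂ := by
  set c : ℍ[ℝ] := ((Complex.exp (-(θ * Complex.I)) : ℂ) : ℍ[ℝ]) with hc
  have hcs : star c * c = 1 := by rw [hc, star_coe_exp_neg, coe_exp_mul_coe_exp_neg]
  have hc0 : c ≠ 0 := by
    rintro h0
    rw [h0, mul_zero] at hcs
    exact zero_ne_one hcs
  have hgt := hft.op_smul hc0
  -- In the basis `f n c` the matrix of `T₂` is `c̄ N₂ c`, which is exactly the matrix of `T₁` in
  -- `e`.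
  obtain ⟨U, hU, hUe⟩ := exists_isQUnitary_map he het (hf.op_smul hcs) hgt
  refine ⟨U, hU, het.ext fun n => ?_⟩
  rw [← sub_eq_zero]
  refine hgt _ fun m => qinner_eq_zero_symm ?_
  have hmn := congrFun (congrFun h m) n
  simp only [matrixOf, adExp, Matrix.of_apply] at hmn
  simp only [mul_apply_eq_comp]
  rw [qinner_sub_left, ← hUe m, IsQUnitary.qinner_map_map hU, hUe, hUe, map_smul, qinner_smul_left,
    qinner_smul_right, hmn, ← star_coe_exp_neg, ← hc]
  simp only [← mul_assoc]
  rw [hcs, one_mul, mul_assoc, hcs, mul_one, sub_self]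

/-- Unitarity and intertwining give `N₁ = c̄ N₂ c`, and `θ` is chosen so that `c = e^{-iθ}`. -/
theorem matrixOf_eq_adExp {T₁ T₂ U : H →L[ℍ[ℝ]ᵐᵒᵖ] H} (hU : IsQUnitary U) (hUT : U * T₁ = T₂ * U)
    {e f : ℕ → H} {c : ℂ} (hc : ‖c‖ = 1) (h : ∀ n, U (e n) = op (c : ℍ[ℝ]) • f n) :
    ∃ θ ∈ Set.Ico (0 : ℝ) (2 * Real.pi), matrixOf T₂ f = adExp θ (matrixOf T₁ e) := by
  obtain ⟨θ, hθ, rfl⟩ := exists_exp_of_norm_eq_one hc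
  refine ⟨θ, hθ, ?_⟩
  ext1 i j
  simp only [matrixOf, adExp, Matrix.of_apply]
  have hj : U (T₁ (e j)) = T₂ (U (e j)) :=
    congrArg (fun L : H →L[ℍ[ℝ]ᵐᵒᵖ] H => L (e j)) hUT
  have hcs : ((Complex.exp (-(θ * Complex.I)) : ℂ) : ℍ[ℝ]) *
      ((Complex.exp (θ * Complex.I) : ℂ) : ℍ[ℝ]) = 1 := by
    rw [← Quaternion.coeComplex_mul, mul_comm, Quaternion.coeComplex_mul,
      coe_exp_mul_coe_exp_neg]
  rw [← IsQUnitary.qinner_map_map hU (T₁ (e j)), hj, h, h, map_smul, qinner_smul_left, qinner_smul_right,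
    star_coe_exp_neg]
  simp only [← mul_assoc]
  rw [hcs, one_mul, mul_assoc, hcs, mul_one]

end Main

end Applications

end

theorem theorem5p1 {H : Type*} [NormedAddCommGroup H] [NormedSpace ℝ H] [Module ℍ[ℝ]ᵐᵒᵖ H]
    [IsScalarTower ℝ ℍ[ℝ]ᵐᵒᵖ H] [QuaternionInnerProductSpace H] [CompleteSpace H]
    [TopologicalSpace.SeparableSpace H]
    (Ωq : Set ℍ[ℝ]) (hopen : IsOpen Ωq) (hconn : IsConnected Ωq) (hsymm : IsAxiallySymmetric Ωq)
    (hreal : ∀ r : ℝ, (r : ℍ[ℝ]) ∉ Ωq)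
    (T₁ T₂ : H →L[ℍ[ℝ]ᵐᵒᵖ] H) (hT₁ : IsCowenDouglas 1 Ωq T₁) (hT₂ : IsCowenDouglas 1 Ωq T₂)
    (ω₀ : ℂ) (hω₀ : ω₀ ∈ reducedSet Ωq) :
    (∃ N₁, IsCanonicalMatrix T₁ Ωq ω₀ N₁) ∧ (∃ N₂, IsCanonicalMatrix T₂ Ωq ω₀ N₂) ∧
      ∀ N₁ N₂ : Matrix ℕ ℕ ℍ[ℝ],
        IsCanonicalMatrix T₁ Ωq ω₀ N₁ → IsCanonicalMatrix T₂ Ωq ω₀ N₂ →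
          (QUnitarilyEquivalent T₁ T₂ ↔
            ∃ θ ∈ Set.Ico (0 : ℝ) (2 * Real.pi), N₂ = adExp θ N₁) := by
  have hex : ∀ T : H →L[ℍ[ℝ]ᵐᵒᵖ] H, IsCowenDouglas 1 Ωq T → ∃ N, IsCanonicalMatrix T Ωq ω₀ N := by
    intro T hT
    obtain ⟨Δ, γ, hΔ, hz, hsub, hγ⟩ := hT.exists_frame hopen hsymm hreal hω₀
    exact ⟨_, Δ, γ, hΔ, hz, hsub, hγ, rfl⟩
  refine ⟨hex T₁ hT₁, hex T₂ hT₂, ?_⟩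
  rintro _ _ ⟨Δ₁, γ₁, hΔ₁, hz₁, hsub₁, hγ₁, rfl⟩ ⟨Δ₂, γ₂, hΔ₂, hz₂, hsub₂, hγ₂, rfl⟩
  have him : ω₀.im ≠ 0 := (im_pos_of_mem_reducedSet hreal hω₀).ne'
  constructor
  · rintro ⟨U, hU, hUT⟩
    -- `γ₂` and `U γ₁` are both frames of `T₂`, so their canonical bases differ by one phase.
    obtain ⟨c, hc, hcU⟩ := hT₂.canonicalBasis_unique hsymm hreal hΔ₂ hΔ₁ hsub₂ hγ₂
      (hγ₁.map_unitary hU hUT hΔ₁) hz₂ hz₁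
    refine matrixOf_eq_adExp hU hUT hc fun n => ?_
    rw [← hcU, hγ₁.canonicalBasis_map_unitary hU hΔ₁ hz₁]
  · rintro ⟨θ, -, h⟩
    exact qUnitarilyEquivalent_of_matrixOf
      (hγ₁.isQOrthonormal_canonicalBasis hΔ₁ hz₁ him)
      (hT₁.isQTotal_canonicalBasis hopen hconn hsymm hreal hΔ₁ hγ₁ hz₁ hω₀)
      (hγ₂.isQOrthonormal_canonicalBasis hΔ₂ hz₂ him)
      (hT₂.isQTotal_canonicalBasis hopen hconn hsymm hreal hΔ₂ hγ₂ hz₂ hω₀) h
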